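/- Let $N\ge 1$, let $f:\mathbb R^N\to\mathbb R$ be $C^1$ with $L_f$-Lipschitz continuous gradient on $\operatorname{dom} g$ for some $L_f>0$, and let $g:\mathbb R^N\to\mathbb R\cup\{+\infty\}$ be proper, lower semi-continuous and prox-bounded, i.e. $\inf_y\big(g(y)+\frac1{2\lambda}\|y-x\|^2\big)>-\infty$ for some $\lambda>0$ and some $x$. Suppose that $h:=f+g$ is coercive ($h(x)\to+\infty$ as $\|x\|\to\infty$) and bounded from below. Notation. For a symmetric positive definite matrix $A$ write $\|x\|_A^2=\langle Ax,x\rangle$, and let $\varsigma(A)$ be the largest $c$ with $\|x\|_A^2\ge c\|x\|^2$ for all $x$. The function $g$ is semi-convex if for some (equivalently, every) symmetric positive definite $A$ there is $m\in\mathbb R$ such that $g-\frac m2\|\cdot\|_A^2$ is convex; the largest such $m$ is the semi-convexity modulus of $g$ with respect to $A$. Put $\sigma=1$ if $g$ is semi-convex and $\sigma=0$ otherwise. $\partial$ denotes the limiting subdifferential, and $\|\partial\varphi(z)\|_-:=\inf_{v\in\partial\varphi(z)}\|v\|$ (with $\inf\emptyset=+\infty$). Algorithm (variable metric iPiano). Let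 $\alpha_n>0$ with $\inf_n\alpha_n>0$, let $\beta_n\ge 0$, and let $A_n$ be symmetric positive definite matrices with $A_n\preceq\mathrm{id}$ and $\inf_n\varsigma(A_n)>0$. Start with $x^0\in\operatorname{dom}h$, $x^{-1}=x^0$, and for $n\ge0$ let $$y^n=x^n+\beta_n(x^n-x^{n-1}),\qquad x^{n+1}\in\arg\min_{x\in\mathbb R^N}\ g(x)+\langle\nabla f(x^n),x-x^n\rangle+\frac1{2\alpha_n}\|x-y^n\|_{A_n}^2 ,$$ where $L_n>\sigma m_n$ is such that $$f(x^{n+1})\le f(x^n)+\langle\nabla f(x^n),x^{n+1}-x^n\rangle+\frac{L_n}2\|x^{n+1}-x^n\|_{A_n}^2 ,$$ $m_n\in\mathbb R$ is, if $\sigma=1$, the semi-convexity modulus of $g$ with respect to $A_n$, and the quantities $$\delta_n^\sigma=\frac12\Big(\frac{1+\sigma-\beta_n}{\alpha_n}-(L_n-\sigma m_n)\Big),\qquad \gamma_n=\delta_n^\sigma-\frac{\beta_n}{2\alpha_n}$$ satisfy $\inf_n\gamma_n>0$ and $\delta_{n+1}^\sigma\|x^{n+1}-x^n\|_{A_{n+1}}^2\le\delta_n^\sigma\|x^{n+1}-x^n\|_{A_n}^2$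 for all $n\ge0$. A function $\varphi$ has the Kurdyka–Łojasiewicz property at $\bar z\in\operatorname{dom}\partial\varphi$ if there are $\eta\in(0,\infty]$, a neighbourhood $U$ of $\bar z$ and a continuous concave $\phi:[0,\eta)\to[0,\infty)$ with $\phi(0)=0$, $\phi\in C^1((0,\eta))$ and $\phi'>0$ on $(0,\eta)$ such that $\phi'(\varphi(z)-\varphi(\bar z))\,\|\partial\varphi(z)\|_-\ge1$ for all $z\in U$ with $\varphi(\bar z)<\varphi(z)<\varphi(\bar z)+\eta$. Theorem. Assume that $F(x,y,A,\delta)=h(x)+\delta\langle A(x-y),x-y\rangle$ on $\mathbb R^N\times\mathbb R^N\times\mathbb R^{N\times N}\times\mathbb R$ is a Kurdyka–Łojasiewicz function; it suffices that it has the Kurdyka–Łojasiewicz property at all $(x,y,A,\delta)\in\operatorname{dom}\partial F$ with $A$ symmetric positive definite and $\delta>0$. Let $(x^n)$ be generated by the algorithm. Then $$\sum_{k=0}^\infty\|x^{k+1}-x^k\|<\infty ,$$ and $(x^n)$ converges to a critical point $x^*\in\operatorname{dom}h$ of $h$, i.e. $0\in\partial h(x^*)$, equivalently $-\nabla f(x^*)\in\partial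 g(x^*)$. -/

import Mathlib

open Filter Topology

namespace VMiPiano

/-- The space `ℝ^N` with its standard Euclidean structure. -/
abbrev Vec (N : ℕ) := EuclideanSpace ℝ (Fin N)

/-! ### Extended-real-valued functions and subdifferentials -/

section Subdifferential

variable {E : Type*} [NormedAddCommGroup E] [InnerProductSpace ℝ E]

/-- The domain `{x | φ x < +∞}`. -/
def effDom (φ : E → EReal) : Set E := {x | φ x < ⊤}

/-- Proper: nowhere `-∞` and not everywhere `+∞`. -/
def IsProper (φ : E → EReal) : Prop := (∀ x, φ x ≠ ⊥) ∧ (effDom φ).Nonempty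

/-- Convexity of an extended-real-valued function: its epigraph is a convex set. -/
def IsConvexFun (φ : E → EReal) : Prop := Convex ℝ {p : E × ℝ | φ p.1 ≤ (p.2 : EReal)}

/-- The Fréchet subdifferential: `v` belongs to it at `z ∈ dom φ` iff
`liminf_{x → z, x ≠ z} (φ x - φ z - ⟪v, x - z⟫) / ‖x - z‖ ≥ 0`, written with `ε`. -/
def frechetSubdiff (φ : E → EReal) (z : E) : Set E :=
  {v | z ∈ effDom φ ∧ ∀ ε : ℝ, 0 < ε → ∀ᶠ x in 𝓝 z,
    φ z + ((inner ℝ v (x - z) - ε * ‖x - z‖ : ℝ) : EReal) ≤ φ x}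

/-- The limiting subdifferential (through `φ`-attentive convergence). -/
def limSubdiff (φ : E → EReal) (z : E) : Set E :=
  {v | z ∈ effDom φ ∧ ∃ (x : ℕ → E) (w : ℕ → E),
    Tendsto x atTop (𝓝 z) ∧ Tendsto (fun n => φ (x n)) atTop (𝓝 (φ z)) ∧
    (∀ n, w n ∈ frechetSubdiff φ (x n)) ∧ Tendsto w atTop (𝓝 v)}

/-- A critical point: a point of the domain with `0 ∈ ∂φ`. -/
def IsCriticalPoint (φ : E → EReal) (z : E) : Prop :=
  z ∈ effDom φ ∧ (0 : E) ∈ limSubdiff φ z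

/-- The lazy slope `inf {‖v‖ | v ∈ ∂φ(z)} ∈ [0, ∞]`, with `inf ∅ = ∞`. -/
noncomputable def lazySlope (φ : E → EReal) (z : E) : ENNReal :=
  ⨅ v ∈ limSubdiff φ z, ENNReal.ofReal ‖v‖

/-- `ψ` is a desingularization function on `[0, η)`, where `η ∈ (0, ∞]`: it is continuous, concave
and non-negative on `[0, η)`, vanishes at `0`, and on `(0, η)` it is `C¹` with positive
derivative. -/
structure IsDesingularizer (η : EReal) (ψ : ℝ → ℝ) : Prop where
  continuousOn : ContinuousOn ψ {s : ℝ | 0 ≤ s ∧ (s : EReal) < η}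
  concaveOn : ConcaveOn ℝ {s : ℝ | 0 ≤ s ∧ (s : EReal) < η} ψ
  nonneg : ∀ s : ℝ, 0 ≤ s → (s : EReal) < η → 0 ≤ ψ s
  zero : ψ 0 = 0
  contDiffOn : ContDiffOn ℝ 1 ψ {s : ℝ | 0 < s ∧ (s : EReal) < η}
  deriv_pos : ∀ s : ℝ, 0 < s → (s : EReal) < η → 0 < deriv ψ s

/-- The Kurdyka–Łojasiewicz property of `φ` at `z`, a point of `dom ∂φ`.  (In the inequality
both values are finite as soon as `φ` is nowhere `-∞`, so that `toReal` is harmless.) -/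
def HasKLProperty (φ : E → EReal) (z : E) : Prop :=
  (limSubdiff φ z).Nonempty ∧
  ∃ (η : EReal) (U : Set E) (ψ : ℝ → ℝ), 0 < η ∧ U ∈ 𝓝 z ∧ IsDesingularizer η ψ ∧
    ∀ x ∈ U, φ z < φ x → φ x < φ z + η →
      1 ≤ ENNReal.ofReal (deriv ψ ((φ x).toReal - (φ z).toReal)) * lazySlope φ x

/-- `φ` is a Kurdyka–Łojasiewicz function on `D`: it is lower semicontinuous on `D` and has the
Kurdyka–Łojasiewicz property at each point of `D ∩ dom ∂φ`.  For `D = univ` this is the notion of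
a Kurdyka–Łojasiewicz function. -/
def IsKLFunctionOn (φ : E → EReal) (D : Set E) : Prop :=
  LowerSemicontinuousOn φ D ∧ ∀ z ∈ D, (limSubdiff φ z).Nonempty → HasKLProperty φ z

/-- Prox-boundedness: some Moreau envelope of `φ` is `> -∞` at some point. -/
def IsProxBounded (φ : E → EReal) : Prop :=
  ∃ r : ℝ, 0 < r ∧ ∃ x : E, ⊥ < ⨅ y : E, φ y + ((1 / (2 * r) * ‖y - x‖ ^ 2 : ℝ) : EReal)

end Subdifferential

/-! ### The metric induced by a matrix -/

/-- `⟨A x, x⟩`, which is `‖x‖_A²` for a symmetric positive definite `A`. -/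
noncomputable def sqNorm {N : ℕ} (A : Matrix (Fin N) (Fin N) ℝ) (x : Vec N) : ℝ :=
  inner ℝ (Matrix.toEuclideanLin A x) x

/-- `ς(A)`: the largest `c` with `‖x‖_A² ≥ c ‖x‖²` for all `x`. -/
noncomputable def varsigma {N : ℕ} (A : Matrix (Fin N) (Fin N) ℝ) : ℝ :=
  sSup {c : ℝ | ∀ x : Vec N, c * ‖x‖ ^ 2 ≤ sqNorm A x}

/-- The `m ∈ ℝ` for which `g - (m/2) ‖·‖_A²` is convex. -/
def semiConvexModuli {N : ℕ} (g : Vec N → EReal) (A : Matrix (Fin N) (Fin N) ℝ) : Set ℝ :=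
  {m : ℝ | IsConvexFun fun x => g x - ((m / 2 * sqNorm A x : ℝ) : EReal)}

/-- `g` is semi-convex with respect to the metric induced by some symmetric positive definite
matrix (equivalently, by any of them). -/
def IsSemiConvex {N : ℕ} (g : Vec N → EReal) : Prop :=
  ∃ A : Matrix (Fin N) (Fin N) ℝ, A.PosDef ∧ (semiConvexModuli g A).Nonempty

/-! ### The algorithm -/

/-- The objective `h = f + g`. -/
noncomputable def objective {N : ℕ} (f : Vec N → ℝ) (g : Vec N → EReal) (x : Vec N) : EReal :=
  (f x : EReal) + g x

/-- The extrapolated point `y^n = x^n + β_n (x^n - x^{n-1})`, where `x^{-1} = x^0` (this is what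
the truncated subtraction `0 - 1 = 0` gives). -/
noncomputable def extrapolate {N : ℕ} (β : ℕ → ℝ) (x : ℕ → Vec N) (n : ℕ) : Vec N :=
  x n + β n • (x n - x (n - 1))

/-- The model `g(z) + ⟨∇f(u), z - u⟩ + 1/(2a) ‖z - y‖_A²`, as a function of `z`. -/
noncomputable def model {N : ℕ} (f : Vec N → ℝ) (g : Vec N → EReal) (u y : Vec N) (a : ℝ)
    (A : Matrix (Fin N) (Fin N) ℝ) (z : Vec N) : EReal :=
  g z + ((inner ℝ (gradient f u) (z - u) + 1 / (2 * a) * sqNorm A (z - y) : ℝ) : EReal)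

/-- `δ_n^σ = ½ ((1 + σ - β_n) / α_n - (L_n - σ m_n))`. -/
noncomputable def deltaPar (σ : ℝ) (α β L m : ℕ → ℝ) (n : ℕ) : ℝ :=
  1 / 2 * ((1 + σ - β n) / α n - (L n - σ * m n))

/-- `γ_n = δ_n^σ - β_n / (2 α_n)`. -/
noncomputable def gammaPar (σ : ℝ) (α β L m : ℕ → ℝ) (n : ℕ) : ℝ :=
  deltaPar σ α β L m n - β n / (2 * α n)

/-- `x` is generated by the variable metric iPiano algorithm for `f + g`, with flag `σ`, step
sizes `α`, inertial parameters `β`, metrics `A`, majorization constants `L` and semi-convexity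
moduli `m` (which matter only when `σ = 1`). -/
structure IsVMiPiano {N : ℕ} (f : Vec N → ℝ) (g : Vec N → EReal) (σ : ℝ) (α β : ℕ → ℝ)
    (A : ℕ → Matrix (Fin N) (Fin N) ℝ) (L m : ℕ → ℝ) (x : ℕ → Vec N) : Prop where
  /-- `σ = 1` if `g` is semi-convex and `σ = 0` otherwise. -/
  flag : (IsSemiConvex g ∧ σ = 1) ∨ (¬ IsSemiConvex g ∧ σ = 0)
  /-- If `σ = 1`, then `m_n` is the semi-convexity modulus of `g` with respect to `A_n`. -/
  modulus : σ = 1 → ∀ n, IsGreatest (semiConvexModuli g (A n)) (m n)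
  alpha_pos : ∀ n, 0 < α n
  /-- `inf_n α_n > 0` -/
  alpha_inf : ∃ c : ℝ, 0 < c ∧ ∀ n, c ≤ α n
  beta_nonneg : ∀ n, 0 ≤ β n
  metric_posDef : ∀ n, (A n).PosDef
  /-- `A_n ⪯ id` -/
  metric_le_one : ∀ n, (1 - A n).PosSemidef
  /-- `inf_n ς(A_n) > 0` -/
  metric_inf : ∃ c : ℝ, 0 < c ∧ ∀ n, c ≤ varsigma (A n)
  start : x 0 ∈ effDom (objective f g)
  /-- `x^{n+1}` is a global minimizer of the model. -/
  update : ∀ n, ∀ z : Vec N,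
    model f g (x n) (extrapolate β x n) (α n) (A n) (x (n + 1)) ≤
      model f g (x n) (extrapolate β x n) (α n) (A n) z
  L_gt : ∀ n, σ * m n < L n
  majorize : ∀ n, f (x (n + 1)) ≤ f (x n) + inner ℝ (gradient f (x n)) (x (n + 1) - x n)
    + L n / 2 * sqNorm (A n) (x (n + 1) - x n)
  /-- `inf_n γ_n > 0` -/
  gamma_inf : ∃ c : ℝ, 0 < c ∧ ∀ n, c ≤ gammaPar σ α β L m n
  delta_step : ∀ n,
    deltaPar σ α β L m (n + 1) * sqNorm (A (n + 1)) (x (n + 1) - x n) ≤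
      deltaPar σ α β L m n * sqNorm (A n) (x (n + 1) - x n)

/-! ### The Lyapunov function -/

/-- The Euclidean space `ℝ^N × ℝ^N × ℝ^{N×N} × ℝ` of the variables `(x, y, A, δ)`. -/
abbrev LyapSpace (N : ℕ) :=
  WithLp 2 (Vec N × WithLp 2 (Vec N × WithLp 2 (EuclideanSpace ℝ (Fin N × Fin N) × ℝ)))

/-- The `x`-component. -/
def LyapSpace.xPart {N : ℕ} (p : LyapSpace N) : Vec N := p.fst

/-- The `y`-component. -/
def LyapSpace.yPart {N : ℕ} (p : LyapSpace N) : Vec N := p.snd.fst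

/-- The `A`-component, as a matrix. -/
def LyapSpace.matPart {N : ℕ} (p : LyapSpace N) : Matrix (Fin N) (Fin N) ℝ :=
  Matrix.of fun i j => p.snd.snd.fst (i, j)

/-- The `δ`-component. -/
def LyapSpace.deltaPart {N : ℕ} (p : LyapSpace N) : ℝ := p.snd.snd.snd

/-- `F(x, y, A, δ) = h(x) + δ ‖x - y‖_A²`, with `‖x - y‖_A² = ⟨A (x - y), x - y⟩`. -/
noncomputable def lyapunov {N : ℕ} (f : Vec N → ℝ) (g : Vec N → EReal) (p : LyapSpace N) : EReal :=
  objective f g p.xPart + ((p.deltaPart * sqNorm p.matPart (p.xPart - p.yPart) : ℝ) : EReal)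

/-- The region of the `(x, y, A, δ)` with `A` symmetric positive definite and `δ > 0`. -/
def LyapRegion (N : ℕ) : Set (LyapSpace N) :=
  {p | p.matPart.PosDef ∧ 0 < p.deltaPart}

end VMiPiano

namespace VMiPiano

/-! ### Real sequences with a desingularized decrease -/

/-! The argument follows the abstract descent scheme for Kurdyka–Łojasiewicz functions, applied to
the Lyapunov function `lyapunov` along the points `lyapIterate`, that is `(x^{n+1}, x^n, A_{n+1},
δ_{n+1})`.

Three facts drive it. The values decrease by at least a multiple of `‖x^{n+1} - x^n‖²`
(`one_step_descent`, `exists_lyapValue_descent`). At each such point there is a subgradient bounded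
by a multiple of the last two step lengths (`exists_residual_le`, `exists_lyapunov_subgradient`).
Every limit point lies in `LyapRegion`, on the limiting level set, and is critical
(`eq_value_of_tendsto`, `lyapunov_limit_point`).

Coercivity, with the bounds on metrics and parameters, keeps these points in a compact ball, so the
inequalities available at the limit points merge into one with a single desingularizer `ψ`
(`exists_uniform_desingularizer`). Concavity of `ψ` then bounds the step lengths by telescoping
differences of `ψ`, and they are summable. The iterates are therefore Cauchy, and optimality in the
update passes to the limit (`critical_of_tendsto`). -/

theorem summable_of_desingularized_descent {a d : ℕ → ℝ} {ψ : ℝ → ℝ} {η c B : ℝ} (hη : 0 < η)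
    (hψ : ConcaveOn ℝ (Set.Ico 0 η) ψ) (hψ0 : ∀ s ∈ Set.Ico 0 η, 0 ≤ ψ s)
    (hψd : ∀ s ∈ Set.Ioo 0 η, 0 < deriv ψ s)
    (hd : ∀ n, 0 ≤ d n) (ha : ∀ n, 0 < a n) (ha0 : Tendsto a atTop (𝓝 0))
    (hc : 0 < c) (hB : 0 ≤ B) (hdesc : ∀ n, c * d n ^ 2 ≤ a n - a (n + 1))
    (hkl : ∀ᶠ n in atTop, 1 ≤ deriv ψ (a (n + 1)) * (B * (d (n + 1) + d n))) :
    Summable d := by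
  obtain ⟨n₀, hn₀⟩ := eventually_atTop.1 (hkl.and (ha0.eventually (gt_mem_nhds hη)))
  have hη' : ∀ n, n₀ ≤ n → a n < η := fun n hn => (hn₀ n hn).2
  have key : ∀ n, n₀ ≤ n →
      d (n + 1) ≤ (d (n + 1) + d n) / 4 + B / c * (ψ (a (n + 1)) - ψ (a (n + 2))) := by
    intro n hn
    have h1 := (hn₀ n hn).1
    have hdes := hdesc (n + 1)
    have hs : 0 ≤ d (n + 1) + d n := add_nonneg (hd _) (hd _)
    have hle : a (n + 2) ≤ a (n + 1) := by nlinarith [sq_nonneg (d (n + 1))]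
    have hD := hψd (a (n + 1)) ⟨ha _, hη' _ (by omega)⟩
    -- Concavity: the tangent slope at the right endpoint is at most the chord slope.
    have hslope : deriv ψ (a (n + 1)) * (a (n + 1) - a (n + 2)) ≤
        ψ (a (n + 1)) - ψ (a (n + 2)) := by
      rcases hle.eq_or_lt with h | h
      · simp [h]
      · have := hψ.deriv_le_slope ⟨(ha (n + 2)).le, hη' _ (by omega)⟩
          ⟨(ha (n + 1)).le, hη' _ (by omega)⟩ h (differentiableAt_of_deriv_ne_zero hD.ne')
        rwa [slope_def_field, le_div_iff₀ (sub_pos.2 h)] at this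
    set s := d (n + 1) + d n
    set P := ψ (a (n + 1)) - ψ (a (n + 2))
    set D := deriv ψ (a (n + 1))
    have hP0 : 0 ≤ P := le_trans (mul_nonneg hD.le (by linarith)) hslope
    have hP : c * d (n + 1) ^ 2 ≤ B * s * P := calc
      c * d (n + 1) ^ 2 ≤ a (n + 1) - a (n + 2) := hdes
      _ ≤ (D * (B * s)) * (a (n + 1) - a (n + 2)) := le_mul_of_one_le_left (by linarith) h1
      _ = (B * s) * (D * (a (n + 1) - a (n + 2))) := by ring
      _ ≤ B * s * P := mul_le_mul_of_nonneg_left hslope (mul_nonneg hB hs)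
    have hM : 0 ≤ B / c * P := by positivity
    have hsq : d (n + 1) ^ 2 ≤ s * (B / c * P) := by
      have : s * (B / c * P) = B * s * P / c := by ring
      rw [this, le_div_iff₀ hc]
      linarith
    -- With `M = B / c * P`, this is the arithmetic–geometric mean inequality `s * M ≤ (s / 4 +
    -- M)²`.
    refine abs_le_of_sq_le_sq' ?_ (by positivity) |>.2
    nlinarith [sq_nonneg (s / 4 - B / c * P)]
  -- In the sum of the inequalities `key`, each interior step occurs on the right with total weight
  -- `1/4 + 1/4`. Half of the sum survives on the left and the `ψ` terms telescope.
  have hsum : ∀ n, 1 / 2 * ∑ k ∈ Finset.range n, d (k + (n₀ + 1)) + d (n₀ + n) / 4 +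
      B / c * ψ (a (n₀ + n + 1)) ≤ d n₀ / 4 + B / c * ψ (a (n₀ + 1)) := by
    intro n
    induction n with
    | zero => simp
    | succ n ih =>
      have := key (n₀ + n) (by omega)
      rw [Finset.sum_range_succ, show n + (n₀ + 1) = n₀ + n + 1 by ring,
        show n₀ + (n + 1) = n₀ + n + 1 by ring]
      linarith
  rw [← summable_nat_add_iff (n₀ + 1)]
  refine summable_of_sum_range_le (c := 2 * (d n₀ / 4 + B / c * ψ (a (n₀ + 1))))
    (fun n => hd _) fun n => ?_
  have h1 := hsum n
  have h2 : 0 ≤ B / c * ψ (a (n₀ + n + 1)) :=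
    mul_nonneg (by positivity) (hψ0 _ ⟨(ha _).le, hη' _ (by omega)⟩)
  linarith [hd (n₀ + n)]

/-! ### Calculus of Fréchet and limiting subgradients -/

section Subgradient

variable {E : Type*} [NormedAddCommGroup E] [InnerProductSpace ℝ E]

theorem frechetSubdiff_subset_limSubdiff (φ : E → EReal) (z : E) :
    frechetSubdiff φ z ⊆ limSubdiff φ z := fun v hv =>
  ⟨hv.1, fun _ => z, fun _ => v, tendsto_const_nhds, tendsto_const_nhds, fun _ => hv,
    tendsto_const_nhds⟩

theorem zero_mem_frechetSubdiff_of_forall_le {φ : E → EReal} {z : E} (hz : z ∈ effDom φ)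
    (h : ∀ x, φ z ≤ φ x) : (0 : E) ∈ frechetSubdiff φ z := by
  refine ⟨hz, fun ε hε => Eventually.of_forall fun x => le_trans ?_ (h x)⟩
  have : ((inner ℝ (0 : E) (x - z) - ε * ‖x - z‖ : ℝ) : EReal) ≤ (0 : ℝ) := by
    rw [EReal.coe_le_coe_iff, inner_zero_left]
    have := mul_nonneg hε.le (norm_nonneg (x - z))
    linarith
  calc _ ≤ φ z + ((0 : ℝ) : EReal) := add_le_add le_rfl this
    _ = φ z := by simp

theorem add_mem_frechetSubdiff [CompleteSpace E] {φ : E → EReal} {q : E → ℝ} {z v w : E}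
    (hv : v ∈ frechetSubdiff φ z) (hq : HasGradientAt q w z) :
    v + w ∈ frechetSubdiff (fun x => φ x + (q x : EReal)) z := by
  refine ⟨EReal.add_lt_top hv.1.ne (EReal.coe_ne_top _), fun ε hε => ?_⟩
  have hlo := (hasGradientAt_iff_isLittleO.1 hq)
  rw [Asymptotics.isLittleO_iff] at hlo
  filter_upwards [hv.2 (ε / 2) (half_pos hε), hlo (half_pos hε)] with x hx hqx
  have h1 : q z + (inner ℝ w (x - z) - ε / 2 * ‖x - z‖) ≤ q x := by
    have := (abs_le.1 (Real.norm_eq_abs _ ▸ hqx)).1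
    linarith
  calc φ z + (q z : EReal) + ((inner ℝ (v + w) (x - z) - ε * ‖x - z‖ : ℝ) : EReal)
      = φ z + ((inner ℝ v (x - z) - ε / 2 * ‖x - z‖ : ℝ) : EReal) +
        ((q z + (inner ℝ w (x - z) - ε / 2 * ‖x - z‖) : ℝ) : EReal) := by
        rw [add_assoc, add_assoc, ← EReal.coe_add, ← EReal.coe_add, inner_add_left]
        congr 2
        ring
    _ ≤ φ x + (q x : EReal) := add_le_add hx (EReal.coe_le_coe_iff.2 h1)

/-- Pull-back of a Fréchet subgradient along the projection to the first factor. -/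
theorem mem_frechetSubdiff_comp_fst {E' : Type*} [NormedAddCommGroup E'] [InnerProductSpace ℝ E']
    {φ : E → EReal} {v : E} {p : WithLp 2 (E × E')} (hv : v ∈ frechetSubdiff φ p.fst) :
    WithLp.toLp 2 (v, (0 : E')) ∈ frechetSubdiff (fun p : WithLp 2 (E × E') => φ p.fst) p := by
  refine ⟨hv.1, fun ε hε => ?_⟩
  have hcont : Tendsto (fun r : WithLp 2 (E × E') => r.fst) (𝓝 p) (𝓝 p.fst) :=
    (WithLp.fstL 2 ℝ E E').continuous.tendsto p
  filter_upwards [hcont.eventually (hv.2 ε hε)] with r hr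
  refine le_trans (add_le_add le_rfl (EReal.coe_le_coe_iff.2 ?_)) hr
  have hn : ‖r.fst - p.fst‖ ≤ ‖r - p‖ := by
    have h := WithLp.prod_norm_sq_eq_of_L2 (r - p)
    refine abs_le_of_sq_le_sq' ?_ (norm_nonneg _) |>.2
    rw [h]
    have : (r - p).fst = r.fst - p.fst := rfl
    rw [this]
    linarith [sq_nonneg ‖(r - p).snd‖]
  have hi : inner ℝ (WithLp.toLp 2 (v, (0 : E'))) (r - p) = inner ℝ v (r.fst - p.fst) := by
    simp [WithLp.prod_inner_apply]
  rw [hi]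
  have := mul_le_mul_of_nonneg_left hn hε.le
  linarith

end Subgradient

/-! ### Quadratic forms of matrices -/

section QuadraticForm

variable {N : ℕ}

/-- A vector of `N × N` entries as a continuous linear endomorphism of `ℝ^N`. -/
noncomputable def entriesToCLM (N : ℕ) :
    EuclideanSpace ℝ (Fin N × Fin N) →L[ℝ] (Vec N →L[ℝ] Vec N) :=
  LinearMap.toContinuousLinearMap
    (LinearMap.toContinuousLinearMap.toLinearMap ∘ₗ
      (Matrix.toEuclideanLin (𝕜 := ℝ) (m := Fin N) (n := Fin N)).toLinearMap ∘ₗ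
      { toFun := fun a => Matrix.of fun i j => a (i, j)
        map_add' := fun _ _ => rfl
        map_smul' := fun _ _ => rfl })

/-- The entries of a matrix as a Euclidean vector. -/
noncomputable def entries (A : Matrix (Fin N) (Fin N) ℝ) : EuclideanSpace ℝ (Fin N × Fin N) :=
  WithLp.toLp 2 fun ij => A ij.1 ij.2

theorem entriesToCLM_entries (A : Matrix (Fin N) (Fin N) ℝ) (u : Vec N) :
    entriesToCLM N (entries A) u = Matrix.toEuclideanLin A u := rfl

theorem sqNorm_eq_dotProduct (A : Matrix (Fin N) (Fin N) ℝ) (u : Vec N) :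
    sqNorm A u = star u.ofLp ⬝ᵥ A.mulVec u.ofLp := by
  simp [sqNorm, EuclideanSpace.inner_eq_star_dotProduct]

@[simp] theorem sqNorm_zero (A : Matrix (Fin N) (Fin N) ℝ) : sqNorm A 0 = 0 := by
  simp [sqNorm]

theorem inner_toEuclideanLin_comm {A : Matrix (Fin N) (Fin N) ℝ} (hA : A.IsHermitian)
    (u v : Vec N) :
    inner ℝ (Matrix.toEuclideanLin A u) v = inner ℝ (Matrix.toEuclideanLin A v) u := by
  rw [Matrix.isSymmetric_toEuclideanLin_iff.2 hA u v, real_inner_comm]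

theorem sqNorm_smul (A : Matrix (Fin N) (Fin N) ℝ) (t : ℝ) (u : Vec N) :
    sqNorm A (t • u) = t ^ 2 * sqNorm A u := by
  simp only [sqNorm, map_smul, inner_smul_left, inner_smul_right, RCLike.conj_to_real]
  ring

theorem sqNorm_add {A : Matrix (Fin N) (Fin N) ℝ} (hA : A.IsHermitian) (u v : Vec N) :
    sqNorm A (u + v) = sqNorm A u + 2 * inner ℝ (Matrix.toEuclideanLin A u) v + sqNorm A v := by
  simp only [sqNorm, map_add, inner_add_left, inner_add_right,
    inner_toEuclideanLin_comm hA v u]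
  ring

theorem sqNorm_sub {A : Matrix (Fin N) (Fin N) ℝ} (hA : A.IsHermitian) (u v : Vec N) :
    sqNorm A (u - v) = sqNorm A u - 2 * inner ℝ (Matrix.toEuclideanLin A u) v + sqNorm A v := by
  simp only [sqNorm, map_sub, inner_sub_left, inner_sub_right,
    inner_toEuclideanLin_comm hA v u]
  ring

theorem sqNorm_nonneg {A : Matrix (Fin N) (Fin N) ℝ} (hA : A.PosSemidef) (u : Vec N) :
    0 ≤ sqNorm A u := by
  rw [sqNorm_eq_dotProduct]
  exact hA.dotProduct_mulVec_nonneg _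

theorem two_mul_inner_toEuclideanLin_le {A : Matrix (Fin N) (Fin N) ℝ} (hA : A.PosSemidef)
    (u v : Vec N) :
    2 * inner ℝ (Matrix.toEuclideanLin A u) v ≤ sqNorm A u + sqNorm A v := by
  have := sqNorm_nonneg hA (u - v)
  rw [sqNorm_sub hA.isHermitian] at this
  linarith

theorem mul_norm_sq_le_sqNorm {A : Matrix (Fin N) (Fin N) ℝ} (hA : A.PosSemidef) {c : ℝ}
    (hc : c ≤ varsigma A) (u : Vec N) : c * ‖u‖ ^ 2 ≤ sqNorm A u := by
  rcases eq_or_ne u 0 with rfl | hu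
  · simp
  have hpos : 0 < ‖u‖ ^ 2 := by positivity
  rw [← le_div_iff₀ hpos]
  -- Nonemptiness of the set matters, since `sSup ∅ = 0` in `ℝ`; the constant `0` belongs to it by
  -- semidefiniteness.
  refine hc.trans (csSup_le ⟨0, fun v => ?_⟩ fun b hb => ?_)
  · simpa using sqNorm_nonneg hA v
  · rw [le_div_iff₀ hpos]
    exact hb u

theorem abs_entry_le_one {A : Matrix (Fin N) (Fin N) ℝ} (hA : A.PosSemidef)
    (hA1 : (1 - A).PosSemidef) (i j : Fin N) : |A i j| ≤ 1 := by
  have hdiag : ∀ k, A k k ≤ 1 := fun k => by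
    have := hA1.diag_nonneg (i := k)
    simpa using this
  have hsymm : A j i = A i j := by
    simpa using hA.isHermitian.apply i j
  -- Testing on `e_i ± e_j` gives `2 |A i j| ≤ A i i + A j j`, and the diagonal entries are at most
  -- `1`.
  have h1 := hA.dotProduct_mulVec_nonneg (Pi.single i 1 + Pi.single j 1)
  have h2 := hA.dotProduct_mulVec_nonneg (Pi.single i 1 - Pi.single j 1)
  simp only [star_trivial, Matrix.mulVec_add, Matrix.mulVec_sub, add_dotProduct, sub_dotProduct,
    dotProduct_add, dotProduct_sub, Matrix.mulVec_single_one, single_one_dotProduct,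
    Matrix.col_apply, hsymm] at h1 h2
  rw [abs_le]
  constructor <;> linarith [hdiag i, hdiag j]

/-- This keeps the metric coordinate of the Lyapunov iterates bounded. -/
theorem norm_entries_le {A : Matrix (Fin N) (Fin N) ℝ} (hA : A.PosSemidef)
    (hA1 : (1 - A).PosSemidef) : ‖entries A‖ ≤ N := by
  refine abs_le_of_sq_le_sq' ?_ (by positivity) |>.2
  rw [EuclideanSpace.norm_sq_eq]
  calc ∑ ij : Fin N × Fin N, ‖entries A ij‖ ^ 2 ≤ ∑ ij : Fin N × Fin N, (1 : ℝ) :=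
        Finset.sum_le_sum fun ij _ =>
          pow_le_one₀ (norm_nonneg _) (abs_entry_le_one hA hA1 ij.1 ij.2)
    _ = (N : ℝ) ^ 2 := by simp [sq]

theorem continuous_sqNorm_entries (u : Vec N) :
    Continuous fun a : EuclideanSpace ℝ (Fin N × Fin N) =>
      sqNorm (Matrix.of fun i j => a (i, j)) u := by
  change Continuous fun a => inner ℝ (entriesToCLM N a u) u
  fun_prop

theorem hasGradientAt_sqNorm_sub {A : Matrix (Fin N) (Fin N) ℝ} (hA : A.IsHermitian)
    (y z : Vec N) :
    HasGradientAt (fun z => sqNorm A (z - y)) ((2 : ℝ) • Matrix.toEuclideanLin A (z - y)) z := by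
  rw [hasGradientAt_iff_hasFDerivAt]
  have h1 : HasFDerivAt (fun z : Vec N => z - y) (ContinuousLinearMap.id ℝ (Vec N)) z :=
    (hasFDerivAt_id z).sub_const y
  have h2 := ((entriesToCLM N (entries A)).hasFDerivAt.comp z h1).inner ℝ h1
  refine h2.congr_fderiv ?_
  ext r
  simp only [ContinuousLinearMap.comp_apply, ContinuousLinearMap.prod_apply, fderivInnerCLM_apply,
    ContinuousLinearMap.id_apply, InnerProductSpace.toDual_apply_apply, inner_smul_left,
    RCLike.conj_to_real, Function.comp_apply, entriesToCLM_entries]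
  rw [inner_toEuclideanLin_comm hA r (z - y)]
  ring

end QuadraticForm

/-! ### Trilinear couplings -/

section Trilinear

variable {E V : Type*} [NormedAddCommGroup E] [InnerProductSpace ℝ E] [CompleteSpace E]
  [NormedAddCommGroup V] [InnerProductSpace ℝ V]

/-- A product `D p * ⟪S p (U p), U p⟫` of linear maps has a gradient of size `O(‖U p‖)` on sets
where the factors are bounded. -/
theorem exists_hasGradientAt_coupling (D : E →L[ℝ] ℝ) (S : E →L[ℝ] (V →L[ℝ] V)) (U : E →L[ℝ] V)
    (p : E) : ∃ w : E, HasGradientAt (fun p => D p * inner ℝ (S p (U p)) (U p)) w p ∧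
      ‖w‖ ≤ (‖D‖ * ‖S p‖ * ‖U p‖ + |D p| * (‖S‖ * ‖U p‖ + 2 * ‖S p‖ * ‖U‖)) * ‖U p‖ := by
  have hd := D.hasFDerivAt (x := p) |>.mul
    ((S.hasFDerivAt (x := p) |>.clm_apply (U.hasFDerivAt (x := p))).inner ℝ
      (U.hasFDerivAt (x := p)))
  set q' := D p • fderivInnerCLM ℝ (S p (U p), U p) ∘SL (S p ∘SL U + S.flip (U p)).prod U +
    inner ℝ (S p (U p)) (U p) • D with hq'
  refine ⟨(InnerProductSpace.toDual ℝ E).symm q', ?_, ?_⟩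
  · rw [hasGradientAt_iff_hasFDerivAt, LinearIsometryEquiv.apply_symm_apply]
    exact hd
  rw [LinearIsometryEquiv.norm_map]
  refine ContinuousLinearMap.opNorm_le_bound _ (by positivity) fun r => ?_
  have hr : q' r = D p * (inner ℝ (S p (U p)) (U r) + (inner ℝ (S p (U r)) (U p) +
      inner ℝ (S r (U p)) (U p))) + inner ℝ (S p (U p)) (U p) * D r := by
    rw [hq']
    simp [fderivInnerCLM_apply, inner_add_left]
  have hDr := D.le_opNorm r
  have hUr := U.le_opNorm r
  have hSr := S.le_opNorm r
  -- The coupling is quadratic in `U`, so every term of the product rule retains at least one factor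
  -- `U p`.
  have b1 : |inner ℝ (S p (U p)) (U r)| ≤ ‖S p‖ * ‖U p‖ * (‖U‖ * ‖r‖) :=
    (abs_real_inner_le_norm _ _).trans (mul_le_mul ((S p).le_opNorm _) hUr (by positivity)
      (by positivity))
  have b2 : |inner ℝ (S p (U r)) (U p)| ≤ ‖S p‖ * (‖U‖ * ‖r‖) * ‖U p‖ :=
    (abs_real_inner_le_norm _ _).trans (mul_le_mul_of_nonneg_right
      (((S p).le_opNorm _).trans (mul_le_mul_of_nonneg_left hUr (norm_nonneg _))) (norm_nonneg _))
  have b3 : |inner ℝ (S r (U p)) (U p)| ≤ ‖S‖ * ‖r‖ * ‖U p‖ * ‖U p‖ :=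
    (abs_real_inner_le_norm _ _).trans (mul_le_mul_of_nonneg_right
      (((S r).le_opNorm _).trans (mul_le_mul_of_nonneg_right hSr (norm_nonneg _))) (norm_nonneg _))
  have b4 : |inner ℝ (S p (U p)) (U p)| ≤ ‖S p‖ * ‖U p‖ * ‖U p‖ :=
    (abs_real_inner_le_norm _ _).trans (mul_le_mul_of_nonneg_right ((S p).le_opNorm _)
      (norm_nonneg _))
  rw [hr, Real.norm_eq_abs]
  calc _ ≤ |D p| * (‖S p‖ * ‖U p‖ * (‖U‖ * ‖r‖) + (‖S p‖ * (‖U‖ * ‖r‖) * ‖U p‖ +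
        ‖S‖ * ‖r‖ * ‖U p‖ * ‖U p‖)) + ‖S p‖ * ‖U p‖ * ‖U p‖ * (‖D‖ * ‖r‖) := by
        refine (abs_add_le _ _).trans (add_le_add ?_ ?_)
        · rw [abs_mul]
          refine mul_le_mul_of_nonneg_left ((abs_add_le _ _).trans (add_le_add b1
            ((abs_add_le _ _).trans (add_le_add b2 b3)))) (abs_nonneg _)
        · rw [abs_mul]
          exact mul_le_mul b4 hDr (abs_nonneg _) (by positivity)
    _ = _ := by ring

end Trilinear

/-! ### One step of the algorithm -/

section Step

variable {N : ℕ} {f : Vec N → ℝ} {g : Vec N → EReal}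

theorem hasGradientAt_inner_sub (c u z : Vec N) :
    HasGradientAt (fun z => inner ℝ c (z - u)) c z := by
  rw [hasGradientAt_iff_hasFDerivAt]
  have h := (hasFDerivAt_const c z).inner ℝ ((hasFDerivAt_id z).sub_const u)
  refine h.congr_fderiv ?_
  ext r
  simp [fderivInnerCLM_apply]

/-- Fermat's rule for the model, after which the smooth part is removed by adding its negative; only
the sum rule with a differentiable function is needed. -/
theorem mem_frechetSubdiff_of_isMin_model {u y z : Vec N} {a : ℝ} {A : Matrix (Fin N) (Fin N) ℝ}
    (hA : A.IsHermitian) (hz : z ∈ effDom g) (hmin : ∀ w, model f g u y a A z ≤ model f g u y a A w) :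
    -(gradient f u + (1 / a) • Matrix.toEuclideanLin A (z - y)) ∈ frechetSubdiff g z := by
  have h0 := zero_mem_frechetSubdiff_of_forall_le (φ := model f g u y a A)
    (EReal.add_lt_top hz.ne (EReal.coe_ne_top _)) hmin
  have hq : HasGradientAt
      (fun z => -(inner ℝ (gradient f u) (z - u) + 1 / (2 * a) * sqNorm A (z - y)))
      (-(gradient f u + (1 / a) • Matrix.toEuclideanLin A (z - y))) z := by
    have h1 := (hasGradientAt_inner_sub (gradient f u) u z)
    have h2 := (hasGradientAt_sqNorm_sub hA y z)
    rw [hasGradientAt_iff_hasFDerivAt] at h1 h2 ⊢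
    refine ((h1.add (h2.const_mul (1 / (2 * a)))).neg).congr_fderiv ?_
    simp only [map_neg, map_add, map_smul, smul_smul]
    rw [show 1 / (2 * a) * 2 = 1 / a by ring]
  have h := add_mem_frechetSubdiff h0 hq
  rw [zero_add] at h
  convert h using 2
  funext w
  change g w = g w + _ + _
  rw [add_assoc, ← EReal.coe_add, add_neg_cancel, EReal.coe_zero, add_zero]

theorem model_le_of_isMin {u y z w : Vec N} {a : ℝ} {A : Matrix (Fin N) (Fin N) ℝ}
    {s : ℝ} (hzb : g z ≠ ⊥) (hz : z ∈ effDom g)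
    (hmin : model f g u y a A z ≤ model f g u y a A w) (hw : g w ≤ (s : EReal)) :
    (g z).toReal + (inner ℝ (gradient f u) (z - u) + 1 / (2 * a) * sqNorm A (z - y)) ≤
      s + (inner ℝ (gradient f u) (w - u) + 1 / (2 * a) * sqNorm A (w - y)) := by
  have h := hmin.trans (add_le_add hw le_rfl)
  rw [model, ← EReal.coe_toReal hz.ne hzb] at h
  exact_mod_cast h

/-- A minimizer of the model satisfies a three-point inequality, improved by the semi-convexity
of `g`. -/
theorem three_point_of_semiConvex {u y z w : Vec N} {a m : ℝ} {A : Matrix (Fin N) (Fin N) ℝ}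
    (hA : A.IsHermitian) (hg : ∀ x, g x ≠ ⊥) (hz : z ∈ effDom g) (hw : w ∈ effDom g)
    (hm : m ∈ semiConvexModuli g A)
    (hmin : ∀ w, model f g u y a A z ≤ model f g u y a A w) :
    (g z).toReal + (inner ℝ (gradient f u) (z - u) + 1 / (2 * a) * sqNorm A (z - y)) +
      (m + 1 / a) / 2 * sqNorm A (w - z) ≤
    (g w).toReal + (inner ℝ (gradient f u) (w - u) + 1 / (2 * a) * sqNorm A (w - y)) := by
  obtain ⟨e, rfl⟩ : ∃ e, w = z + e := ⟨w - z, by abel⟩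
  rw [add_sub_cancel_left]
  have hepi : ∀ v, v ∈ effDom g → g v - ((m / 2 * sqNorm A v : ℝ) : EReal) ≤
      (((g v).toReal - m / 2 * sqNorm A v : ℝ) : EReal) := fun v hv => by
    rw [EReal.coe_sub, EReal.coe_toReal hv.ne (hg v)]
  -- The minimizer is compared with `z + t • e` instead of `w`. Convexity of `g - (m/2) ‖·‖_A²` and
  -- the quadratic model term contribute curvature `t (1 - t) (m + 1/a) / 2`; dividing by `t` and
  -- letting `t → 0` yields the claim.
  have hineq : ∀ t : ℝ, 0 < t → t ≤ 1 →
      (g z).toReal + (inner ℝ (gradient f u) (z - u) + 1 / (2 * a) * sqNorm A (z - y)) +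
        (1 - t) * ((m + 1 / a) / 2 * sqNorm A e) ≤
      (g (z + e)).toReal +
        (inner ℝ (gradient f u) (z + e - u) + 1 / (2 * a) * sqNorm A (z + e - y)) := by
    intro t ht ht1
    have hc := hm (show (z, (g z).toReal - m / 2 * sqNorm A z) ∈ _ from hepi z hz)
      (show (z + e, (g (z + e)).toReal - m / 2 * sqNorm A (z + e)) ∈ _ from hepi _ hw)
      (sub_nonneg.2 ht1) ht.le (by ring)
    have hpt : (1 - t) • z + t • (z + e) = z + t • e := by module
    simp only [Set.mem_ofPred_eq, Prod.smul_mk, Prod.mk_add_mk, hpt, smul_eq_mul] at hc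
    have hgt : g (z + t • e) ≤ (((1 - t) * ((g z).toReal - m / 2 * sqNorm A z) +
        t * ((g (z + e)).toReal - m / 2 * sqNorm A (z + e)) +
        m / 2 * sqNorm A (z + t • e) : ℝ) : EReal) := by
      rw [EReal.coe_add]
      exact EReal.sub_le_iff_le_add (Or.inl (EReal.coe_ne_bot _))
        (Or.inl (EReal.coe_ne_top _)) |>.1 hc
    have h := model_le_of_isMin (hg z) hz (hmin _) hgt
    have e1 : z + t • e - u = (z - u) + t • e := by abel
    have e2 : z + t • e - y = (z - y) + t • e := by abel
    have e3 : z + e - u = (z - u) + e := by abel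
    have e4 : z + e - y = (z - y) + e := by abel
    simp only [e1, e2, e3, e4, sqNorm_add hA, sqNorm_smul, inner_add_right,
      inner_smul_right] at h ⊢
    refine le_of_mul_le_mul_left ?_ ht
    rw [show 1 / (2 * a) = 1 / a / 2 by ring] at h ⊢
    nlinarith
  have hlim : Tendsto (fun t : ℝ =>
      (g z).toReal + (inner ℝ (gradient f u) (z - u) + 1 / (2 * a) * sqNorm A (z - y)) +
        (1 - t) * ((m + 1 / a) / 2 * sqNorm A e)) (𝓝[>] 0) (𝓝 
      ((g z).toReal + (inner ℝ (gradient f u) (z - u) + 1 / (2 * a) * sqNorm A (z - y)) +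
        (1 - 0) * ((m + 1 / a) / 2 * sqNorm A e))) :=
    (Continuous.tendsto (by fun_prop) 0).mono_left nhdsWithin_le_nhds
  rw [sub_zero, one_mul] at hlim
  refine le_of_tendsto hlim ?_
  filter_upwards [Ioc_mem_nhdsGT (zero_lt_one' ℝ)] with t ht using hineq t ht.1 ht.2

end Step

/-! ### The iterates -/

namespace IsVMiPiano

variable {N : ℕ} {f : Vec N → ℝ} {g : Vec N → EReal} {σ : ℝ} {α β : ℕ → ℝ}
  {A : ℕ → Matrix (Fin N) (Fin N) ℝ} {L m : ℕ → ℝ} {x : ℕ → Vec N}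

theorem mem_effDom (hx : IsVMiPiano f g σ α β A L m x) (n : ℕ) : x n ∈ effDom g := by
  have h0 : x 0 ∈ effDom g := by
    refine (lt_top_iff_ne_top (a := g (x 0))).2 fun h => ?_
    have := hx.start
    simp [effDom, objective, h] at this
  cases n with
  | zero => exact h0
  | succ n =>
    refine (lt_top_iff_ne_top (a := g (x (n + 1)))).2 fun h => ?_
    have h1 := hx.update n (x 0)
    rw [model, h, EReal.top_add_coe, top_le_iff, model] at h1
    -- The starting point is a competitor with finite model value in every update.
    exact (EReal.add_lt_top h0.ne (EReal.coe_ne_top _)).ne h1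

theorem three_point (hx : IsVMiPiano f g σ α β A L m x) (hg : ∀ x, g x ≠ ⊥) (n : ℕ) {w : Vec N}
    (hw : w ∈ effDom g) :
    (g (x (n + 1))).toReal + (inner ℝ (gradient f (x n)) (x (n + 1) - x n) +
        1 / (2 * α n) * sqNorm (A n) (x (n + 1) - extrapolate β x n)) +
      σ * (m n + 1 / α n) / 2 * sqNorm (A n) (w - x (n + 1)) ≤
    (g w).toReal + (inner ℝ (gradient f (x n)) (w - x n) +
        1 / (2 * α n) * sqNorm (A n) (w - extrapolate β x n)) := by
  have hH := (hx.metric_posDef n).isHermitian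
  rcases hx.flag with ⟨-, hσ⟩ | ⟨-, hσ⟩
  · have := three_point_of_semiConvex hH hg (hx.mem_effDom (n + 1)) hw (hx.modulus hσ n).1
      (hx.update n)
    rw [hσ, one_mul]
    exact this
  · have := model_le_of_isMin (hg _) (hx.mem_effDom (n + 1)) (hx.update n w)
      (EReal.coe_toReal hw.ne (hg w)).ge
    rw [hσ, zero_mul, zero_div, zero_mul, add_zero]
    exact this

theorem sigma_le_one (hx : IsVMiPiano f g σ α β A L m x) : σ ≤ 1 := by
  rcases hx.flag with ⟨-, hσ⟩ | ⟨-, hσ⟩ <;> simp [hσ]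

theorem one_step_descent (hx : IsVMiPiano f g σ α β A L m x) (hg : ∀ x, g x ≠ ⊥) (n : ℕ) :
    f (x (n + 1)) + (g (x (n + 1))).toReal +
        deltaPar σ α β L m n * sqNorm (A n) (x (n + 1) - x n) ≤
      f (x n) + (g (x n)).toReal + (deltaPar σ α β L m n - gammaPar σ α β L m n) *
        sqNorm (A n) (x n - x (n - 1)) := by
  have hA := hx.metric_posDef n
  -- With competitor `x n`, the terms in `β n ^ 2` cancel. The remaining cross term is split by
  -- Young's inequality in the metric `A n` (`hcs`); its share `β n / (2 * α n)` on the previous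
  -- step is exactly `δ_n - γ_n`.
  have h3 := hx.three_point hg n (hx.mem_effDom n)
  have hmaj := hx.majorize n
  have e1 : x (n + 1) - extrapolate β x n = (x (n + 1) - x n) - β n • (x n - x (n - 1)) := by
    rw [extrapolate]; abel
  have e2 : x n - extrapolate β x n = (-β n) • (x n - x (n - 1)) := by
    rw [extrapolate]; module
  have e3 : x n - x (n + 1) = (-1 : ℝ) • (x (n + 1) - x n) := by module
  rw [e1, e2, e3, sub_self, inner_zero_right, sqNorm_sub hA.isHermitian, sqNorm_smul, sqNorm_smul,
    sqNorm_smul, inner_smul_right] at h3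
  have hcs := mul_le_mul_of_nonneg_left (two_mul_inner_toEuclideanLin_le hA.posSemidef
    (x (n + 1) - x n) (x n - x (n - 1)))
    (div_nonneg (hx.beta_nonneg n) (mul_pos two_pos (hx.alpha_pos n)).le)
  rw [deltaPar, gammaPar, deltaPar]
  have i1 : 1 / (2 * α n) = 1 / α n / 2 := by ring
  have i2 : β n / (2 * α n) = β n * (1 / α n) / 2 := by ring
  have i3 : (1 + σ - β n) / α n = (1 + σ - β n) * (1 / α n) := by ring
  rw [i1] at h3
  rw [i2] at hcs ⊢
  rw [i3]
  nlinarith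

theorem exists_gamma_le_delta (hx : IsVMiPiano f g σ α β A L m x) : ∃ c : ℝ, 0 < c ∧
    ∀ n, c ≤ gammaPar σ α β L m n ∧ c ≤ deltaPar σ α β L m n := by
  obtain ⟨c, hc, h⟩ := hx.gamma_inf
  refine ⟨c, hc, fun n => ⟨h n, (h n).trans ?_⟩⟩
  rw [gammaPar]
  have := div_nonneg (hx.beta_nonneg n) (mul_pos two_pos (hx.alpha_pos n)).le
  linarith

theorem delta_le (hx : IsVMiPiano f g σ α β A L m x) (n : ℕ) :
    deltaPar σ α β L m n ≤ 1 / α n := by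
  have h1 : (1 + σ - β n) / α n ≤ 2 / α n :=
    div_le_div_of_nonneg_right (by linarith [hx.sigma_le_one, hx.beta_nonneg n])
      (hx.alpha_pos n).le
  have h2 : 2 / α n = 2 * (1 / α n) := by ring
  rw [deltaPar]
  linarith [hx.L_gt n]

/-- Since `σ ≤ 1` and `σ m_n < L_n`, `δ_n ≤ (2 - β_n) / (2 α_n)`, so `γ_n > 0` forces `2 - 2 β_n >
0`. The extrapolation is thereby controlled by the previous step. -/
theorem beta_le_one (hx : IsVMiPiano f g σ α β A L m x) (n : ℕ) : β n ≤ 1 := by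
  obtain ⟨c, hc, h⟩ := hx.gamma_inf
  have hn := h n
  rw [gammaPar] at hn
  have h1 := hx.delta_le n
  have h2 : 0 < 1 / α n - β n / (2 * α n) := by linarith
  have h3 := hx.alpha_pos n
  have hd : deltaPar σ α β L m n ≤ (2 - β n) / (2 * α n) := by
    rw [deltaPar]
    have : (1 + σ - β n) / α n ≤ (2 - β n) / α n :=
      div_le_div_of_nonneg_right (by linarith [hx.sigma_le_one]) h3.le
    have e : (2 - β n) / (2 * α n) = 1 / 2 * ((2 - β n) / α n) := by field_simp
    rw [e]
    linarith [hx.L_gt n]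
  have h4 : 0 < (2 - β n) / (2 * α n) - β n / (2 * α n) := by linarith
  rw [← sub_div] at h4
  have h5 := (div_pos_iff_of_pos_right (by positivity : 0 < 2 * α n)).1 h4
  linarith

end IsVMiPiano

/-! ### Subgradients of the Lyapunov function -/

section Lyapunov

variable {N : ℕ} {f : Vec N → ℝ} {g : Vec N → EReal}

theorem add_gradient_mem_frechetSubdiff_objective {z v : Vec N} (hf : DifferentiableAt ℝ f z)
    (hv : v ∈ frechetSubdiff g z) : v + gradient f z ∈ frechetSubdiff (objective f g) z := by
  have h := add_mem_frechetSubdiff hv hf.hasGradientAt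
  have e : objective f g = fun x => g x + (f x : EReal) := funext fun x => add_comm _ _
  rwa [e]

/-- The point `(x, y, A, δ)`. -/
noncomputable def lyapPoint (x y : Vec N) (A : Matrix (Fin N) (Fin N) ℝ) (δ : ℝ) : LyapSpace N :=
  WithLp.toLp 2 (x, WithLp.toLp 2 (y, WithLp.toLp 2 (entries A, δ)))

theorem norm_toLp_prod_le {E E' : Type*} [NormedAddCommGroup E] [NormedAddCommGroup E']
    (a : E) (b : E') : ‖WithLp.toLp 2 (a, b)‖ ≤ ‖a‖ + ‖b‖ := by
  refine abs_le_of_sq_le_sq' ?_ (by positivity) |>.2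
  rw [WithLp.prod_norm_sq_eq_of_L2]
  change ‖a‖ ^ 2 + ‖b‖ ^ 2 ≤ _
  nlinarith [mul_nonneg (norm_nonneg a) (norm_nonneg b)]

theorem norm_lyapPoint_le (x y : Vec N) (A : Matrix (Fin N) (Fin N) ℝ) (δ : ℝ) :
    ‖lyapPoint x y A δ‖ ≤ ‖x‖ + (‖y‖ + (‖entries A‖ + |δ|)) :=
  (norm_toLp_prod_le _ _).trans (add_le_add le_rfl ((norm_toLp_prod_le _ _).trans
    (add_le_add le_rfl (norm_toLp_prod_le _ _))))

theorem lyapunov_lyapPoint (x y : Vec N) (A : Matrix (Fin N) (Fin N) ℝ) (δ : ℝ) :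
    lyapunov f g (lyapPoint x y A δ) = objective f g x + ((δ * sqNorm A (x - y) : ℝ) : EReal) :=
  rfl

/-- On bounded sets the smooth part of the Lyapunov function contributes `O(‖x - y‖)` to its
subgradients. -/
theorem exists_frechetSubdiff_lyapunov (R : ℝ) : ∃ C : ℝ, 0 ≤ C ∧ ∀ p : LyapSpace N, ‖p‖ ≤ R →
    ∀ v ∈ frechetSubdiff (objective f g) p.xPart,
      ∃ w ∈ frechetSubdiff (lyapunov f g) p, ‖w‖ ≤ ‖v‖ + C * ‖p.xPart - p.yPart‖ := by
  let P1 := WithLp.fstL 2 ℝ (Vec N) (WithLp 2 (Vec N × WithLp 2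
    (EuclideanSpace ℝ (Fin N × Fin N) × ℝ)))
  let P2 := WithLp.sndL 2 ℝ (Vec N) (WithLp 2 (Vec N × WithLp 2
    (EuclideanSpace ℝ (Fin N × Fin N) × ℝ)))
  let Q1 := WithLp.fstL 2 ℝ (Vec N) (WithLp 2 (EuclideanSpace ℝ (Fin N × Fin N) × ℝ))
  let Q2 := WithLp.sndL 2 ℝ (Vec N) (WithLp 2 (EuclideanSpace ℝ (Fin N × Fin N) × ℝ))
  -- `D`, `S` and `U` read off `δ`, `A` and `x - y`, so the smooth part of the Lyapunov function is
  -- `D p * ⟪S p (U p), U p⟫`.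
  let D : LyapSpace N →L[ℝ] ℝ :=
    (WithLp.sndL 2 ℝ (EuclideanSpace ℝ (Fin N × Fin N)) ℝ).comp (Q2.comp P2)
  let S : LyapSpace N →L[ℝ] (Vec N →L[ℝ] Vec N) := (entriesToCLM N).comp
    ((WithLp.fstL 2 ℝ (EuclideanSpace ℝ (Fin N × Fin N)) ℝ).comp (Q2.comp P2))
  let U : LyapSpace N →L[ℝ] Vec N := P1 - Q1.comp P2
  refine ⟨‖D‖ * (‖S‖ * |R|) * (‖U‖ * |R|) +
    ‖D‖ * |R| * (‖S‖ * (‖U‖ * |R|) + 2 * (‖S‖ * |R|) * ‖U‖), by positivity, fun p hp v hv => ?_⟩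
  obtain ⟨w, hw, hwn⟩ := exists_hasGradientAt_coupling D S U p
  refine ⟨_, add_mem_frechetSubdiff (mem_frechetSubdiff_comp_fst hv) hw, ?_⟩
  have hpR : ‖p‖ ≤ |R| := hp.trans (le_abs_self R)
  have hD : |D p| ≤ ‖D‖ * |R| := (D.le_opNorm p).trans (by gcongr)
  have hS : ‖S p‖ ≤ ‖S‖ * |R| := (S.le_opNorm p).trans (by gcongr)
  have hU : ‖U p‖ ≤ ‖U‖ * |R| := (U.le_opNorm p).trans (by gcongr)
  refine (norm_add_le _ _).trans (add_le_add ?_ (hwn.trans ?_))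
  · simp
  · change _ ≤ _ * ‖U p‖
    gcongr

end Lyapunov

/-! ### Asymptotics of the iterates -/

namespace IsVMiPiano

variable {N : ℕ} {f : Vec N → ℝ} {g : Vec N → EReal} {σ : ℝ} {α β : ℕ → ℝ}
  {A : ℕ → Matrix (Fin N) (Fin N) ℝ} {L m : ℕ → ℝ} {x : ℕ → Vec N}

theorem exists_norm_toEuclideanLin_le (hx : IsVMiPiano f g σ α β A L m x) :
    ∃ C : ℝ, 0 ≤ C ∧ ∀ n u, ‖Matrix.toEuclideanLin (A n) u‖ ≤ C * ‖u‖ := by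
  refine ⟨‖entriesToCLM N‖ * N, by positivity, fun n u => ?_⟩
  rw [← entriesToCLM_entries]
  refine ((entriesToCLM N (entries (A n))).le_opNorm u).trans
    (mul_le_mul_of_nonneg_right (((entriesToCLM N).le_opNorm _).trans ?_) (norm_nonneg _))
  exact mul_le_mul_of_nonneg_left
    (norm_entries_le (hx.metric_posDef n).posSemidef (hx.metric_le_one n)) (norm_nonneg _)

theorem exists_sqNorm_le (hx : IsVMiPiano f g σ α β A L m x) :
    ∃ C : ℝ, 0 ≤ C ∧ ∀ n u, sqNorm (A n) u ≤ C * ‖u‖ ^ 2 := by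
  obtain ⟨C, hC, h⟩ := hx.exists_norm_toEuclideanLin_le
  refine ⟨C, hC, fun n u => (real_inner_le_norm _ _).trans ?_⟩
  rw [sq, ← mul_assoc]
  exact mul_le_mul_of_nonneg_right (h n u) (norm_nonneg _)

theorem exists_inv_alpha_le (hx : IsVMiPiano f g σ α β A L m x) :
    ∃ C : ℝ, 0 ≤ C ∧ ∀ n, 1 / α n ≤ C := by
  obtain ⟨c, hc, h⟩ := hx.alpha_inf
  exact ⟨1 / c, by positivity, fun n => one_div_le_one_div_of_le hc (h n)⟩

/-- The iterates are approximately critical, with an error bounded by the last two steps. -/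
theorem exists_residual_le (hx : IsVMiPiano f g σ α β A L m x) {Lf : ℝ} (hLf : 0 ≤ Lf)
    (hf_lip : ∀ u ∈ effDom g, ∀ v ∈ effDom g, ‖gradient f u - gradient f v‖ ≤ Lf * ‖u - v‖) :
    ∃ B : ℝ, 0 ≤ B ∧ ∀ n, ∃ v ∈ frechetSubdiff g (x (n + 1)),
      ‖v + gradient f (x (n + 1))‖ ≤ B * (‖x (n + 1) - x n‖ + ‖x n - x (n - 1)‖) := by
  obtain ⟨C, hC, hA⟩ := hx.exists_norm_toEuclideanLin_le
  obtain ⟨a, ha, hα⟩ := hx.exists_inv_alpha_le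
  refine ⟨Lf + a * C, by positivity, fun n => ⟨_, mem_frechetSubdiff_of_isMin_model
    (hx.metric_posDef n).isHermitian (hx.mem_effDom (n + 1)) (hx.update n), ?_⟩⟩
  set y := extrapolate β x n with hy
  have hstep : ‖x (n + 1) - y‖ ≤ ‖x (n + 1) - x n‖ + ‖x n - x (n - 1)‖ := by
    have e : x (n + 1) - y = (x (n + 1) - x n) - β n • (x n - x (n - 1)) := by
      rw [hy, extrapolate]; abel
    rw [e]
    refine (norm_sub_le _ _).trans (add_le_add le_rfl ?_)
    rw [norm_smul, Real.norm_of_nonneg (hx.beta_nonneg n)]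
    exact mul_le_of_le_one_left (norm_nonneg _) (hx.beta_le_one n)
  -- The residual consists of a gradient difference, bounded through `Lf`, and a metric term,
  -- bounded through `a * C`.
  have e : -(gradient f (x n) + (1 / α n) • Matrix.toEuclideanLin (A n) (x (n + 1) - y)) +
      gradient f (x (n + 1)) = (gradient f (x (n + 1)) - gradient f (x n)) -
        (1 / α n) • Matrix.toEuclideanLin (A n) (x (n + 1) - y) := by abel
  rw [e]
  have h1 := hf_lip _ (hx.mem_effDom (n + 1)) _ (hx.mem_effDom n)
  have h2 : ‖(1 / α n) • Matrix.toEuclideanLin (A n) (x (n + 1) - y)‖ ≤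
      a * (C * (‖x (n + 1) - x n‖ + ‖x n - x (n - 1)‖)) := by
    rw [norm_smul, Real.norm_of_nonneg (one_div_pos.2 (hx.alpha_pos n)).le]
    exact mul_le_mul (hα n) ((hA n _).trans (mul_le_mul_of_nonneg_left hstep hC))
      (norm_nonneg _) ha
  refine (norm_sub_le _ _).trans ((add_le_add h1 h2).trans ?_)
  have := mul_nonneg hLf (norm_nonneg (x n - x (n - 1)))
  linarith

/-- The value of the Lyapunov function at `(x^{n+1}, x^n, A_{n+1}, δ_{n+1})`. -/
noncomputable def lyapValue (f : Vec N → ℝ) (g : Vec N → EReal) (σ : ℝ) (α β : ℕ → ℝ)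
    (A : ℕ → Matrix (Fin N) (Fin N) ℝ) (L m : ℕ → ℝ) (x : ℕ → Vec N) (n : ℕ) : ℝ :=
  f (x (n + 1)) + (g (x (n + 1))).toReal +
    deltaPar σ α β L m (n + 1) * sqNorm (A (n + 1)) (x (n + 1) - x n)

/-- The point `(x^{n+1}, x^n, A_{n+1}, δ_{n+1})`. -/
noncomputable def lyapIterate (σ : ℝ) (α β : ℕ → ℝ)
    (A : ℕ → Matrix (Fin N) (Fin N) ℝ) (L m : ℕ → ℝ) (x : ℕ → Vec N) (n : ℕ) : LyapSpace N :=
  lyapPoint (x (n + 1)) (x n) (A (n + 1)) (deltaPar σ α β L m (n + 1))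

theorem objective_iterate (hx : IsVMiPiano f g σ α β A L m x) (hg : ∀ x, g x ≠ ⊥) (n : ℕ) :
    objective f g (x n) = ((f (x n) + (g (x n)).toReal : ℝ) : EReal) := by
  rw [EReal.coe_add, EReal.coe_toReal (hx.mem_effDom n).ne (hg _)]
  rfl

theorem lyapunov_lyapIterate (hx : IsVMiPiano f g σ α β A L m x) (hg : ∀ x, g x ≠ ⊥) (n : ℕ) :
    lyapunov f g (lyapIterate σ α β A L m x n) = (lyapValue f g σ α β A L m x n : EReal) := by
  rw [lyapIterate, lyapunov_lyapPoint, hx.objective_iterate hg, lyapValue, ← EReal.coe_add]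

theorem exists_lyapValue_descent (hx : IsVMiPiano f g σ α β A L m x) (hg : ∀ x, g x ≠ ⊥) :
    ∃ c : ℝ, 0 < c ∧ ∀ n, c * ‖x (n + 1) - x n‖ ^ 2 ≤
      lyapValue f g σ α β A L m x n - lyapValue f g σ α β A L m x (n + 1) := by
  obtain ⟨c, hc, hγ⟩ := hx.gamma_inf
  obtain ⟨c', hc', hA⟩ := hx.metric_inf
  refine ⟨c * c', mul_pos hc hc', fun n => ?_⟩
  -- Step `n + 1` measures the old difference in `A_{n+1}`, which is why the Lyapunov points carry
  -- `A_{n+1}` and `δ_{n+1}`; `delta_step` then exchanges these for `A_{n+2}` and `δ_{n+2}` on the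
  -- new difference.
  have h1 := hx.one_step_descent hg (n + 1)
  have h2 := hx.delta_step (n + 1)
  have h3 := mul_norm_sq_le_sqNorm (hx.metric_posDef (n + 1)).posSemidef (hA (n + 1))
    (x (n + 1) - x n)
  have h4 := mul_le_mul (hγ (n + 1)) h3 (by positivity) (hc.le.trans (hγ (n + 1)))
  rw [Nat.add_sub_cancel] at h1
  rw [lyapValue, lyapValue]
  linarith

theorem deltaPar_mul_sqNorm_nonneg (hx : IsVMiPiano f g σ α β A L m x) (n : ℕ) (u : Vec N) :
    0 ≤ deltaPar σ α β L m n * sqNorm (A n) u := by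
  obtain ⟨c, hc, h⟩ := hx.exists_gamma_le_delta
  exact mul_nonneg (hc.le.trans (h n).2) (sqNorm_nonneg (hx.metric_posDef n).posSemidef u)

theorem antitone_lyapValue (hx : IsVMiPiano f g σ α β A L m x) (hg : ∀ x, g x ≠ ⊥) :
    Antitone (lyapValue f g σ α β A L m x) := by
  obtain ⟨c, hc, h⟩ := hx.exists_lyapValue_descent hg
  refine antitone_nat_of_succ_le fun n => ?_
  have : 0 ≤ c * ‖x (n + 1) - x n‖ ^ 2 := by positivity
  linarith [h n]

theorem exists_tendsto_lyapValue (hx : IsVMiPiano f g σ α β A L m x) (hg : ∀ x, g x ≠ ⊥)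
    (hh : ∃ c : ℝ, ∀ u, (c : EReal) ≤ objective f g u) :
    ∃ ζ : ℝ, Tendsto (lyapValue f g σ α β A L m x) atTop (𝓝 ζ) := by
  obtain ⟨c, hc⟩ := hh
  refine ⟨_, tendsto_atTop_ciInf (hx.antitone_lyapValue hg) ⟨c, ?_⟩⟩
  rintro _ ⟨n, rfl⟩
  have h1 := hc (x (n + 1))
  rw [hx.objective_iterate hg, EReal.coe_le_coe_iff] at h1
  rw [lyapValue]
  linarith [hx.deltaPar_mul_sqNorm_nonneg (n + 1) (x (n + 1) - x n)]

theorem tendsto_norm_step (hx : IsVMiPiano f g σ α β A L m x) (hg : ∀ x, g x ≠ ⊥)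
    {ζ : ℝ} (hζ : Tendsto (lyapValue f g σ α β A L m x) atTop (𝓝 ζ)) :
    Tendsto (fun n => ‖x (n + 1) - x n‖) atTop (𝓝 0) := by
  obtain ⟨c, hc, h⟩ := hx.exists_lyapValue_descent hg
  have h1 : Tendsto (fun n => (lyapValue f g σ α β A L m x n -
      lyapValue f g σ α β A L m x (n + 1)) / c) atTop (𝓝 0) := by
    simpa using (hζ.sub (hζ.comp (tendsto_add_atTop_nat 1))).div_const c
  have h2 : Tendsto (fun n => ‖x (n + 1) - x n‖ ^ 2) atTop (𝓝 0) :=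
    squeeze_zero (fun n => by positivity) (fun n => by
      rw [le_div_iff₀ hc, mul_comm]; exact h n) h1
  simpa [Real.sqrt_sq] using h2.sqrt

theorem tendsto_norm_prev_step {x : ℕ → Vec N}
    (h : Tendsto (fun n => ‖x (n + 1) - x n‖) atTop (𝓝 0)) :
    Tendsto (fun n => ‖x n - x (n - 1)‖) atTop (𝓝 0) :=
  (tendsto_add_atTop_iff_nat 1).1 (by simpa using h)

theorem exists_norm_iterate_le (hx : IsVMiPiano f g σ α β A L m x) (hg : ∀ x, g x ≠ ⊥)
    (hh : Tendsto (objective f g) (cocompact (Vec N)) (𝓝 ⊤)) :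
    ∃ R : ℝ, ∀ n, ‖x n‖ ≤ R := by
  have hev := hh.eventually (lt_mem_nhds (EReal.coe_lt_top (lyapValue f g σ α β A L m x 0)))
  obtain ⟨K, hK, hKs⟩ := mem_cocompact.1 hev
  obtain ⟨R, hR⟩ := hK.isBounded.exists_norm_le
  -- `lyapValue` at index `n` controls only `x (n + 1)`, so `x 0` enters the bound separately.
  refine ⟨max R ‖x 0‖, fun n => ?_⟩
  cases n with
  | zero => exact le_max_right _ _
  | succ n =>
    refine (hR _ ?_).trans (le_max_left _ _)
    by_contra hn
    have h1 : (lyapValue f g σ α β A L m x 0 : EReal) < objective f g (x (n + 1)) := hKs hn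
    rw [hx.objective_iterate hg, EReal.coe_lt_coe_iff] at h1
    have h2 := hx.antitone_lyapValue hg (Nat.zero_le n)
    rw [lyapValue] at h2
    linarith [hx.deltaPar_mul_sqNorm_nonneg (n + 1) (x (n + 1) - x n)]

theorem exists_norm_lyapIterate_le (hx : IsVMiPiano f g σ α β A L m x) (hg : ∀ x, g x ≠ ⊥)
    (hh : Tendsto (objective f g) (cocompact (Vec N)) (𝓝 ⊤)) :
    ∃ R : ℝ, ∀ n, ‖lyapIterate σ α β A L m x n‖ ≤ R := by
  obtain ⟨R, hR⟩ := hx.exists_norm_iterate_le hg hh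
  obtain ⟨a, ha, hα⟩ := hx.exists_inv_alpha_le
  obtain ⟨c, hc, hδ⟩ := hx.exists_gamma_le_delta
  refine ⟨R + (R + (N + a)), fun n => (norm_lyapPoint_le _ _ _ _).trans ?_⟩
  gcongr
  · exact hR _
  · exact hR _
  · exact norm_entries_le (hx.metric_posDef _).posSemidef (hx.metric_le_one _)
  · rw [abs_of_pos (hc.trans_le (hδ _).2)]
    exact (hx.delta_le _).trans (hα _)

theorem exists_lyapunov_subgradient (hx : IsVMiPiano f g σ α β A L m x) (hg : ∀ x, g x ≠ ⊥)
    (hf : Differentiable ℝ f) {Lf : ℝ} (hLf : 0 ≤ Lf)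
    (hf_lip : ∀ u ∈ effDom g, ∀ v ∈ effDom g, ‖gradient f u - gradient f v‖ ≤ Lf * ‖u - v‖)
    (hh : Tendsto (objective f g) (cocompact (Vec N)) (𝓝 ⊤)) :
    ∃ B : ℝ, 0 ≤ B ∧ ∀ n, ∃ w ∈ frechetSubdiff (lyapunov f g) (lyapIterate σ α β A L m x n),
      ‖w‖ ≤ B * (‖x (n + 1) - x n‖ + ‖x n - x (n - 1)‖) := by
  obtain ⟨R, hR⟩ := hx.exists_norm_lyapIterate_le hg hh
  obtain ⟨B, hB, hres⟩ := hx.exists_residual_le hLf hf_lip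
  obtain ⟨C, hC, hlyap⟩ := exists_frechetSubdiff_lyapunov (f := f) (g := g) R
  refine ⟨B + C, by positivity, fun n => ?_⟩
  obtain ⟨v, hv, hvn⟩ := hres n
  obtain ⟨w, hw, hwn⟩ := hlyap _ (hR n) _
    (add_gradient_mem_frechetSubdiff_objective (hf (x (n + 1))) hv)
  refine ⟨w, hw, hwn.trans ?_⟩
  change ‖v + gradient f (x (n + 1))‖ + C * ‖x (n + 1) - x n‖ ≤ _
  have := mul_nonneg hC (norm_nonneg (x n - x (n - 1)))
  linarith

/-! ### Limit points -/

theorem tendsto_value_iterate (hx : IsVMiPiano f g σ α β A L m x) (hg : ∀ x, g x ≠ ⊥)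
    {ζ : ℝ} (hζ : Tendsto (lyapValue f g σ α β A L m x) atTop (𝓝 ζ)) :
    Tendsto (fun n => f (x (n + 1)) + (g (x (n + 1))).toReal) atTop (𝓝 ζ) := by
  obtain ⟨C, hC, hA⟩ := hx.exists_sqNorm_le
  obtain ⟨a, ha, hα⟩ := hx.exists_inv_alpha_le
  have hd := hx.tendsto_norm_step hg hζ
  have h0 : Tendsto (fun n => deltaPar σ α β L m (n + 1) *
      sqNorm (A (n + 1)) (x (n + 1) - x n)) atTop (𝓝 0) := by
    refine squeeze_zero (g := fun n => a * (C * ‖x (n + 1) - x n‖ ^ 2))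
      (fun n => hx.deltaPar_mul_sqNorm_nonneg _ _) (fun n => ?_) ?_
    · exact mul_le_mul ((hx.delta_le _).trans (hα _)) (hA _ _)
        (sqNorm_nonneg (hx.metric_posDef _).posSemidef _) ha
    · simpa using ((hd.pow 2).const_mul C).const_mul a
  simpa [lyapValue] using hζ.sub h0

/-- At limit points of the iterates, `g` takes the limit value. -/
theorem eq_value_of_tendsto (hx : IsVMiPiano f g σ α β A L m x) (hg : ∀ x, g x ≠ ⊥)
    (hg_lsc : LowerSemicontinuous g) (hf : ContDiff ℝ 1 f)
    {ζ : ℝ} (hζ : Tendsto (lyapValue f g σ α β A L m x) atTop (𝓝 ζ))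
    {k : ℕ → ℕ} (hk : Tendsto k atTop atTop) {u : Vec N}
    (hu : Tendsto (fun i => x (k i + 1)) atTop (𝓝 u)) :
    g u = ((ζ - f u : ℝ) : EReal) := by
  obtain ⟨C, hC, hA⟩ := hx.exists_sqNorm_le
  obtain ⟨a, ha, hα⟩ := hx.exists_inv_alpha_le
  have hd := hx.tendsto_norm_step hg hζ
  have he := tendsto_norm_prev_step hd
  have hG : Tendsto (fun i => (g (x (k i + 1))).toReal) atTop (𝓝 (ζ - f u)) := by
    have := ((hx.tendsto_value_iterate hg hζ).comp hk).sub ((hf.continuous.tendsto u).comp hu)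
    simpa [Function.comp_def] using this
  -- Lower semicontinuity gives this bound and places `u` in `dom g`. Only then can `u` serve as a
  -- competitor in the updates, which supplies the reverse inequality that semicontinuity alone does
  -- not give.
  have hle : g u ≤ ((ζ - f u : ℝ) : EReal) := by
    refine le_of_forall_lt fun y hy => ?_
    obtain ⟨y', hyy', hy'⟩ := exists_between hy
    refine hyy'.trans_le (ge_of_tendsto (EReal.tendsto_coe.2 hG) ?_)
    filter_upwards [hu.eventually (hg_lsc u y' hy')] with i hi
    rw [EReal.coe_toReal (hx.mem_effDom _).ne (hg _)]
    exact hi.le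
  have hudom : u ∈ effDom g := hle.trans_lt (EReal.coe_lt_top _)
  refine le_antisymm hle ?_
  rw [← EReal.coe_toReal hudom.ne (hg u), EReal.coe_le_coe_iff]
  have hu' : Tendsto (fun i => x (k i)) atTop (𝓝 u) := by
    have : Tendsto (fun i => x (k i + 1) - x (k i)) atTop (𝓝 0) :=
      tendsto_zero_iff_norm_tendsto_zero.2 (hd.comp hk)
    simpa using hu.sub this
  have hgrad : Tendsto (fun i => gradient f (x (k i))) atTop (𝓝 (gradient f u)) := by
    have hc : Continuous (gradient f) :=
      (InnerProductSpace.toDual ℝ (Vec N)).symm.continuous.comp (hf.continuous_fderiv one_ne_zero)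
    exact (hc.tendsto u).comp hu'
  have hin : Tendsto (fun i => inner ℝ (gradient f (x (k i))) (u - x (k i + 1))) atTop (𝓝 0) := by
    have h1 := hgrad.inner (𝕜 := ℝ) ((tendsto_const_nhds (x := u)).sub hu)
    simpa using h1
  have hy : Tendsto (fun i => ‖u - x (k i)‖ + ‖x (k i) - x (k i - 1)‖) atTop (𝓝 0) := by
    simpa using ((tendsto_const_nhds (x := u)).sub hu').norm.add (he.comp hk)
  have hbound : Tendsto (fun i => (g u).toReal +
      inner ℝ (gradient f (x (k i))) (u - x (k i + 1)) +
      a / 2 * (C * (‖u - x (k i)‖ + ‖x (k i) - x (k i - 1)‖) ^ 2)) atTop (𝓝 (g u).toReal) := by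
    simpa using (hin.const_add (g u).toReal).add (((hy.pow 2).const_mul C).const_mul (a / 2))
  refine le_of_tendsto_of_tendsto' hG hbound fun i => ?_
  have h1 := model_le_of_isMin (hg _) (hx.mem_effDom (k i + 1)) (hx.update (k i) u)
    (EReal.coe_toReal hudom.ne (hg u)).ge
  have hαi := one_div_pos.2 (hx.alpha_pos (k i))
  have hpos := mul_nonneg hαi.le (sqNorm_nonneg (hx.metric_posDef (k i)).posSemidef
    (x (k i + 1) - extrapolate β x (k i)))
  have hey : ‖u - extrapolate β x (k i)‖ ≤ ‖u - x (k i)‖ + ‖x (k i) - x (k i - 1)‖ := by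
    have e : u - extrapolate β x (k i) =
        (u - x (k i)) - β (k i) • (x (k i) - x (k i - 1)) := by
      rw [extrapolate]; abel
    rw [e]
    refine (norm_sub_le _ _).trans (add_le_add le_rfl ?_)
    rw [norm_smul, Real.norm_of_nonneg (hx.beta_nonneg _)]
    exact mul_le_of_le_one_left (norm_nonneg _) (hx.beta_le_one _)
  have hq : 1 / α (k i) * sqNorm (A (k i)) (u - extrapolate β x (k i)) ≤
      a * (C * (‖u - x (k i)‖ + ‖x (k i) - x (k i - 1)‖) ^ 2) :=
    mul_le_mul (hα _) ((hA _ _).trans (by gcongr))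
      (sqNorm_nonneg (hx.metric_posDef (k i)).posSemidef _) ha
  have hi : inner ℝ (gradient f (x (k i))) (u - x (k i + 1)) =
      inner ℝ (gradient f (x (k i))) (u - x (k i)) -
        inner ℝ (gradient f (x (k i))) (x (k i + 1) - x (k i)) := by
    rw [← inner_sub_right]
    congr 1
    abel
  rw [hi]
  rw [show 1 / (2 * α (k i)) = 1 / α (k i) / 2 by ring] at h1
  linarith

/-- The limit of the iterates is a critical point. -/
theorem critical_of_tendsto (hx : IsVMiPiano f g σ α β A L m x) (hg : ∀ x, g x ≠ ⊥)
    (hg_lsc : LowerSemicontinuous g) (hf : ContDiff ℝ 1 f) {Lf : ℝ} (hLf : 0 ≤ Lf)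
    (hf_lip : ∀ u ∈ effDom g, ∀ v ∈ effDom g, ‖gradient f u - gradient f v‖ ≤ Lf * ‖u - v‖)
    {ζ : ℝ} (hζ : Tendsto (lyapValue f g σ α β A L m x) atTop (𝓝 ζ))
    {u : Vec N} (hu : Tendsto x atTop (𝓝 u)) :
    IsCriticalPoint (objective f g) u ∧ -gradient f u ∈ limSubdiff g u := by
  have hu1 : Tendsto (fun n => x (n + 1)) atTop (𝓝 u) := hu.comp (tendsto_add_atTop_nat 1)
  have hgu := hx.eq_value_of_tendsto hg hg_lsc hf hζ tendsto_id hu1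
  have hudom : u ∈ effDom g := by
    change g u < ⊤
    rw [hgu]
    exact EReal.coe_lt_top _
  have hou : objective f g u = (ζ : EReal) := by
    rw [objective, hgu, ← EReal.coe_add, add_sub_cancel]
  have hd := hx.tendsto_norm_step hg hζ
  obtain ⟨B, hB, hres⟩ := hx.exists_residual_le hLf hf_lip
  choose v hv hvn using hres
  have hv0 : Tendsto (fun n => v n + gradient f (x (n + 1))) atTop (𝓝 0) := by
    refine squeeze_zero_norm hvn ?_
    simpa using (hd.add (tendsto_norm_prev_step hd)).const_mul B
  have hgrad : Tendsto (fun n => gradient f (x (n + 1))) atTop (𝓝 (gradient f u)) := by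
    have hc : Continuous (gradient f) :=
      (InnerProductSpace.toDual ℝ (Vec N)).symm.continuous.comp (hf.continuous_fderiv one_ne_zero)
    exact (hc.tendsto u).comp hu1
  have hval := hx.tendsto_value_iterate hg hζ
  have hodom : u ∈ effDom (objective f g) := by
    change objective f g u < ⊤
    rw [hou]
    exact EReal.coe_lt_top _
  -- Both inclusions come from the same Fréchet subgradients `v n` of `g`, with convergence of the
  -- values of `h` and `g` respectively; no sum rule for limiting subdifferentials is involved.
  refine ⟨⟨hodom, hodom, fun n => x (n + 1), _, hu1, ?_, fun n =>
    add_gradient_mem_frechetSubdiff_objective (hf.differentiable one_ne_zero _) (hv n), hv0⟩,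
    hudom, fun n => x (n + 1), v, hu1, ?_, hv, ?_⟩
  · rw [hou]
    simp only [hx.objective_iterate hg]
    exact EReal.tendsto_coe.2 hval
  · rw [hgu]
    have h : Tendsto (fun n => (g (x (n + 1))).toReal) atTop (𝓝 (ζ - f u)) := by
      simpa [Function.comp_def] using hval.sub ((hf.continuous.tendsto u).comp hu1)
    refine (EReal.tendsto_coe.2 h).congr fun n => EReal.coe_toReal (hx.mem_effDom _).ne (hg _)
  · simpa using hv0.sub hgrad

/-- Limit points of `(x^{n+1}, x^n, A_{n+1}, δ_{n+1})` lie in the region of positive definite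
metrics, on the limit level set of the Lyapunov function, and are critical. -/
theorem lyapunov_limit_point (hx : IsVMiPiano f g σ α β A L m x) (hg : ∀ x, g x ≠ ⊥)
    (hg_lsc : LowerSemicontinuous g) (hf : ContDiff ℝ 1 f) {Lf : ℝ} (hLf : 0 ≤ Lf)
    (hf_lip : ∀ u ∈ effDom g, ∀ v ∈ effDom g, ‖gradient f u - gradient f v‖ ≤ Lf * ‖u - v‖)
    (hh : Tendsto (objective f g) (cocompact (Vec N)) (𝓝 ⊤))
    {ζ : ℝ} (hζ : Tendsto (lyapValue f g σ α β A L m x) atTop (𝓝 ζ))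
    {k : ℕ → ℕ} (hk : Tendsto k atTop atTop) {p : LyapSpace N}
    (hp : Tendsto (fun i => lyapIterate σ α β A L m x (k i)) atTop (𝓝 p)) :
    p ∈ LyapRegion N ∧ lyapunov f g p = (ζ : EReal) ∧
      (0 : LyapSpace N) ∈ limSubdiff (lyapunov f g) p := by
  have hd := hx.tendsto_norm_step hg hζ
  have hx1 : Tendsto (fun i => x (k i + 1)) atTop (𝓝 p.fst) :=
    ((WithLp.fstL 2 ℝ _ _).continuous.tendsto p).comp hp
  have hp2 := ((WithLp.sndL 2 ℝ _ _).continuous.tendsto p).comp hp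
  have hx0 : Tendsto (fun i => x (k i)) atTop (𝓝 p.snd.fst) :=
    ((WithLp.fstL 2 ℝ _ _).continuous.tendsto _).comp hp2
  have hp3 := ((WithLp.sndL 2 ℝ _ _).continuous.tendsto _).comp hp2
  have ha : Tendsto (fun i => entries (A (k i + 1))) atTop (𝓝 p.snd.snd.fst) :=
    ((WithLp.fstL 2 ℝ _ _).continuous.tendsto _).comp hp3
  have hδ : Tendsto (fun i => deltaPar σ α β L m (k i + 1)) atTop (𝓝 p.snd.snd.snd) :=
    ((WithLp.sndL 2 ℝ _ _).continuous.tendsto _).comp hp3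
  have hxy : p.xPart = p.yPart := by
    have h1 : Tendsto (fun i => x (k i + 1) - x (k i)) atTop (𝓝 0) :=
      tendsto_zero_iff_norm_tendsto_zero.2 (hd.comp hk)
    exact sub_eq_zero.1 (tendsto_nhds_unique (hx1.sub hx0) h1)
  have hF : lyapunov f g p = (ζ : EReal) := by
    have hgu : g p.xPart = _ := hx.eq_value_of_tendsto hg hg_lsc hf hζ hk hx1
    rw [lyapunov, hxy, sub_self, sqNorm_zero, mul_zero, EReal.coe_zero, add_zero, ← hxy, objective,
      hgu, ← EReal.coe_add]
    congr 1
    exact add_sub_cancel _ _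
  have hmatH : p.matPart.IsHermitian := by
    have hentry : ∀ i j, Tendsto (fun n => A (k n + 1) i j) atTop (𝓝 (p.matPart i j)) :=
      fun i j => ((EuclideanSpace.proj (𝕜 := ℝ) (i, j)).continuous.tendsto _).comp ha
    refine Matrix.IsHermitian.ext fun i j => ?_
    refine tendsto_nhds_unique (hentry j i) ((hentry i j).congr fun n => ?_)
    simpa using ((hx.metric_posDef (k n + 1)).isHermitian.apply j i)
  obtain ⟨c, hc, hA⟩ := hx.metric_inf
  obtain ⟨c', hc', hδc⟩ := hx.exists_gamma_le_delta
  -- The uniform lower bound on `ς(A_n)` survives the limit, so the limiting metric is definite and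
  -- not merely semidefinite.
  have hform : ∀ u : Vec N, c * ‖u‖ ^ 2 ≤ sqNorm p.matPart u := fun u =>
    ge_of_tendsto (((continuous_sqNorm_entries u).tendsto _).comp ha)
      (Eventually.of_forall fun i =>
        mul_norm_sq_le_sqNorm (hx.metric_posDef (k i + 1)).posSemidef (hA _) u)
  refine ⟨⟨Matrix.PosDef.of_dotProduct_mulVec_pos hmatH fun u hu => ?_, ?_⟩, hF, ?_⟩
  · have h := hform (WithLp.toLp 2 u)
    rw [sqNorm_eq_dotProduct] at h
    have : 0 < ‖WithLp.toLp 2 u‖ := norm_pos_iff.2 (by simpa using hu)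
    exact lt_of_lt_of_le (by positivity) h
  · exact hc'.trans_le (ge_of_tendsto' hδ fun i => (hδc _).2)
  · obtain ⟨B, hB, hsub⟩ :=
      hx.exists_lyapunov_subgradient hg (hf.differentiable one_ne_zero) hLf hf_lip hh
    choose w hw hwn using hsub
    refine ⟨?_, fun i => lyapIterate σ α β A L m x (k i), fun i => w (k i), hp, ?_,
      fun i => hw _, ?_⟩
    · change lyapunov f g p < ⊤
      rw [hF]
      exact EReal.coe_lt_top _
    · rw [hF]
      simp only [hx.lyapunov_lyapIterate hg]
      exact EReal.tendsto_coe.2 (hζ.comp hk)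
    · refine Tendsto.comp (squeeze_zero_norm hwn ?_) hk
      simpa using (hd.add (tendsto_norm_prev_step hd)).const_mul B

end IsVMiPiano

/-! ### Uniformized Kurdyka–Łojasiewicz inequalities -/

/-- `ψ` is concave and non-negative on `[0, η)` and has a positive derivative on `(0, η)`. -/
structure IsDesingularizerOn (η : ℝ) (ψ : ℝ → ℝ) : Prop where
  pos : 0 < η
  concaveOn : ConcaveOn ℝ (Set.Ico 0 η) ψ
  nonneg : ∀ s ∈ Set.Ico 0 η, 0 ≤ ψ s
  deriv_pos : ∀ s ∈ Set.Ioo 0 η, 0 < deriv ψ s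

theorem IsDesingularizerOn.id : IsDesingularizerOn 1 fun s => s where
  pos := one_pos
  concaveOn := concaveOn_id (convex_Ico 0 1)
  nonneg _ hs := hs.1
  deriv_pos s _ := by simp

/-- Since `η` may be `⊤`, it is replaced by a smaller positive real. -/
theorem IsDesingularizer.exists_isDesingularizerOn {η : EReal} {ψ : ℝ → ℝ} (hη : 0 < η)
    (h : IsDesingularizer η ψ) : ∃ r : ℝ, (r : EReal) < η ∧ IsDesingularizerOn r ψ := by
  obtain ⟨r, hr0, hrη⟩ := EReal.lt_iff_exists_real_btwn.1 hη
  have hlt : ∀ s : ℝ, s < r → (s : EReal) < η := fun s hs =>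
    (EReal.coe_lt_coe_iff.2 hs).trans hrη
  exact ⟨r, hrη, EReal.coe_pos.1 hr0,
    h.concaveOn.subset (fun s hs => ⟨hs.1, hlt s hs.2⟩) (convex_Ico 0 r),
    fun s hs => h.nonneg s hs.1 (hlt s hs.2), fun s hs => h.deriv_pos s hs.1 (hlt s hs.2)⟩

section Add

variable {η₁ η₂ : ℝ} {ψ₁ ψ₂ : ℝ → ℝ}

/-- A nonzero `deriv` entails differentiability, because `deriv` defaults to `0` elsewhere. -/
theorem IsDesingularizerOn.deriv_add (h₁ : IsDesingularizerOn η₁ ψ₁)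
    (h₂ : IsDesingularizerOn η₂ ψ₂) {s : ℝ} (hs : s ∈ Set.Ioo 0 (min η₁ η₂)) :
    deriv (ψ₁ + ψ₂) s = deriv ψ₁ s + deriv ψ₂ s ∧ 0 < deriv ψ₁ s ∧ 0 < deriv ψ₂ s := by
  have d₁ := h₁.deriv_pos s ⟨hs.1, hs.2.trans_le (min_le_left _ _)⟩
  have d₂ := h₂.deriv_pos s ⟨hs.1, hs.2.trans_le (min_le_right _ _)⟩
  exact ⟨_root_.deriv_add (differentiableAt_of_deriv_ne_zero d₁.ne')
    (differentiableAt_of_deriv_ne_zero d₂.ne'), d₁, d₂⟩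

theorem IsDesingularizerOn.add (h₁ : IsDesingularizerOn η₁ ψ₁) (h₂ : IsDesingularizerOn η₂ ψ₂) :
    IsDesingularizerOn (min η₁ η₂) (ψ₁ + ψ₂) := by
  have s₁ : Set.Ico 0 (min η₁ η₂) ⊆ Set.Ico 0 η₁ := Set.Ico_subset_Ico_right (min_le_left _ _)
  have s₂ : Set.Ico 0 (min η₁ η₂) ⊆ Set.Ico 0 η₂ := Set.Ico_subset_Ico_right (min_le_right _ _)
  refine ⟨lt_min h₁.pos h₂.pos, (h₁.concaveOn.subset s₁ (convex_Ico _ _)).add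
    (h₂.concaveOn.subset s₂ (convex_Ico _ _)),
    fun s hs => add_nonneg (h₁.nonneg s (s₁ hs)) (h₂.nonneg s (s₂ hs)), fun s hs => ?_⟩
  obtain ⟨e, d₁, d₂⟩ := h₁.deriv_add h₂ hs
  rw [e]
  exact add_pos d₁ d₂

end Add

/-- A sequence in a compact set whose limit points all satisfy a desingularization inequality,
locally along the sequence, eventually satisfies one with a single desingularizer. -/
theorem exists_uniform_desingularizer {X : Type*} [TopologicalSpace X] {K : Set X}
    (hK : IsCompact K) {z : ℕ → X} (hz : ∀ n, z n ∈ K) {a b : ℕ → ℝ} (ha : ∀ n, 0 < a n)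
    (ha0 : Tendsto a atTop (𝓝 0)) (hb : ∀ n, 0 ≤ b n)
    (hloc : ∀ p, MapClusterPt p atTop z → ∃ V ∈ 𝓝 p, ∃ η ψ, IsDesingularizerOn η ψ ∧
      ∀ᶠ n in atTop, z n ∈ V → 1 ≤ deriv ψ (a n) * b n) :
    ∃ η ψ, IsDesingularizerOn η ψ ∧ ∀ᶠ n in atTop, 1 ≤ deriv ψ (a n) * b n := by
  have h := hK.induction_on (p := fun S => ∃ η ψ, IsDesingularizerOn η ψ ∧
      ∀ᶠ n in atTop, z n ∈ S → 1 ≤ deriv ψ (a n) * b n)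
    ⟨1, _, IsDesingularizerOn.id, by simp⟩ ?_ ?_ ?_
  · obtain ⟨η, ψ, hψ, hev⟩ := h
    exact ⟨η, ψ, hψ, hev.mono fun n hn => hn (hz n)⟩
  · rintro s t hst ⟨η, ψ, hψ, hev⟩
    exact ⟨η, ψ, hψ, hev.mono fun n hn hs => hn (hst hs)⟩
  · rintro s t ⟨η₁, ψ₁, h₁, hev₁⟩ ⟨η₂, ψ₂, h₂, hev₂⟩
    -- Adding a desingularizer only increases the derivative, so the sum serves both pieces of a
    -- union.
    refine ⟨_, _, h₁.add h₂, ?_⟩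
    filter_upwards [hev₁, hev₂, ha0.eventually (gt_mem_nhds (lt_min h₁.pos h₂.pos))]
      with n hn₁ hn₂ hlt hst
    obtain ⟨e, d₁, d₂⟩ := h₁.deriv_add h₂ ⟨ha n, hlt⟩
    rw [e, add_mul]
    rcases hst with hs | ht
    · linarith [hn₁ hs, mul_nonneg d₂.le (hb n)]
    · linarith [hn₂ ht, mul_nonneg d₁.le (hb n)]
  · intro p _
    by_cases hp : MapClusterPt p atTop z
    · obtain ⟨V, hV, h⟩ := hloc p hp
      exact ⟨V, mem_nhdsWithin_of_mem_nhds hV, h⟩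
    · rw [mapClusterPt_iff_frequently] at hp
      push Not at hp
      obtain ⟨V, hV, hev⟩ := hp
      refine ⟨V, mem_nhdsWithin_of_mem_nhds hV, 1, _, IsDesingularizerOn.id, ?_⟩
      filter_upwards [hev] with n hn hnV using absurd hnV hn

theorem lazySlope_le {E : Type*} [NormedAddCommGroup E] [InnerProductSpace ℝ E] {φ : E → EReal}
    {z w : E} (hw : w ∈ limSubdiff φ z) : lazySlope φ z ≤ ENNReal.ofReal ‖w‖ :=
  iInf₂_le w hw

/-- The Kurdyka–Łojasiewicz inequality along a sequence whose values decrease to the value at the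
base point. -/
theorem HasKLProperty.exists_desingularizer_along {E : Type*} [NormedAddCommGroup E]
    [InnerProductSpace ℝ E] {φ : E → EReal} {p : E} (h : HasKLProperty φ p) {ζ : ℝ}
    (hp : φ p = (ζ : EReal)) {z w : ℕ → E} {Φ b : ℕ → ℝ} (hz : ∀ n, φ (z n) = (Φ n : EReal))
    (hΦ : ∀ n, ζ < Φ n) (hlim : Tendsto Φ atTop (𝓝 ζ)) (hw : ∀ n, w n ∈ limSubdiff φ (z n))
    (hb : ∀ n, ‖w n‖ ≤ b n) :
    ∃ V ∈ 𝓝 p, ∃ η ψ, IsDesingularizerOn η ψ ∧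
      ∀ᶠ n in atTop, z n ∈ V → 1 ≤ deriv ψ (Φ n - ζ) * b n := by
  obtain ⟨-, η, V, ψ, hη, hV, hψ, hKL⟩ := h
  obtain ⟨r, hrη, hr⟩ := hψ.exists_isDesingularizerOn hη
  refine ⟨V, hV, r, ψ, hr, ?_⟩
  filter_upwards [hlim.eventually (gt_mem_nhds (lt_add_of_pos_right ζ hr.pos))] with n hn hnV
  have h1 : φ p < φ (z n) := by
    rw [hp, hz]
    exact EReal.coe_lt_coe_iff.2 (hΦ n)
  have h2 : φ (z n) < φ p + η := by
    rw [hp, hz]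
    refine (EReal.coe_lt_coe_iff.2 hn).trans_le ?_
    rw [EReal.coe_add]
    exact add_le_add le_rfl hrη.le
  have h3 := hKL _ hnV h1 h2
  rw [hp, hz, EReal.toReal_coe, EReal.toReal_coe] at h3
  have hd := hr.deriv_pos (Φ n - ζ) ⟨sub_pos.2 (hΦ n), by linarith⟩
  have h4 := h3.trans (mul_le_mul_right (lazySlope_le (hw n)) _)
  rw [← ENNReal.ofReal_mul hd.le, ENNReal.one_le_ofReal] at h4
  exact h4.trans (mul_le_mul_of_nonneg_left (hb n) hd.le)

/-! ### Convergence -/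

namespace IsVMiPiano

variable {N : ℕ} {f : Vec N → ℝ} {g : Vec N → EReal} {σ : ℝ} {α β : ℕ → ℝ}
  {A : ℕ → Matrix (Fin N) (Fin N) ℝ} {L m : ℕ → ℝ} {x : ℕ → Vec N}

theorem summable_norm_step (hx : IsVMiPiano f g σ α β A L m x) (hg : ∀ x, g x ≠ ⊥)
    (hg_lsc : LowerSemicontinuous g) (hf : ContDiff ℝ 1 f) {Lf : ℝ} (hLf : 0 ≤ Lf)
    (hf_lip : ∀ u ∈ effDom g, ∀ v ∈ effDom g, ‖gradient f u - gradient f v‖ ≤ Lf * ‖u - v‖)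
    (hh : Tendsto (objective f g) (cocompact (Vec N)) (𝓝 ⊤))
    (hKL : IsKLFunctionOn (lyapunov f g) (LyapRegion N))
    {ζ : ℝ} (hζ : Tendsto (lyapValue f g σ α β A L m x) atTop (𝓝 ζ)) :
    Summable fun n => ‖x (n + 1) - x n‖ := by
  obtain ⟨c, hc, hdesc⟩ := hx.exists_lyapValue_descent hg
  have hanti := hx.antitone_lyapValue hg
  -- The Kurdyka–Łojasiewicz inequality requires values strictly above `ζ`. If the limit value is
  -- attained, monotonicity makes the values constant from then on, and all later steps vanish.
  by_cases hpos : ∀ n, ζ < lyapValue f g σ α β A L m x n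
  · obtain ⟨R, hR⟩ := hx.exists_norm_lyapIterate_le hg hh
    obtain ⟨B, hB, hsub⟩ :=
      hx.exists_lyapunov_subgradient hg (hf.differentiable one_ne_zero) hLf hf_lip hh
    choose w hw hwn using hsub
    have ha0 : Tendsto (fun n => lyapValue f g σ α β A L m x n - ζ) atTop (𝓝 0) := by
      simpa using hζ.sub_const ζ
    obtain ⟨η, ψ, hψ, hev⟩ := exists_uniform_desingularizer
      (isCompact_closedBall (0 : LyapSpace N) R)
      (fun n => mem_closedBall_zero_iff.2 (hR n)) (fun n => sub_pos.2 (hpos n)) ha0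
      (b := fun n => B * (‖x (n + 1) - x n‖ + ‖x n - x (n - 1)‖)) (fun n => by positivity)
      fun p hp => by
        obtain ⟨k, hk, hkp⟩ := hp.tendsto_subseq
        obtain ⟨hmem, hF, h0⟩ := hx.lyapunov_limit_point hg hg_lsc hf hLf hf_lip hh hζ
          hk.tendsto_atTop hkp
        exact (hKL.2 p hmem ⟨0, h0⟩).exists_desingularizer_along hF
          (hx.lyapunov_lyapIterate hg) hpos hζ
          (fun n => frechetSubdiff_subset_limSubdiff _ _ (hw n)) hwn
    refine summable_of_desingularized_descent hψ.pos hψ.concaveOn hψ.nonneg hψ.deriv_pos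
      (fun n => norm_nonneg _) (fun n => sub_pos.2 (hpos n)) ha0 hc hB
      (fun n => by rw [sub_sub_sub_cancel_right]; exact hdesc n) ?_
    -- Shifting the index by one turns the steps `n` and `n - 1` in `hev` into `n + 1` and `n`, so
    -- the truncated subtraction disappears.
    exact (tendsto_add_atTop_nat 1).eventually hev
  · push Not at hpos
    obtain ⟨n₀, hn₀⟩ := hpos
    rw [← summable_nat_add_iff n₀]
    refine summable_zero.congr fun n => ?_
    have h1 := hdesc (n + n₀)
    have h2 := hanti.le_of_tendsto hζ (n + n₀ + 1)
    have h3 := hanti (Nat.le_add_left n₀ n)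
    have h4 : c * ‖x (n + n₀ + 1) - x (n + n₀)‖ ^ 2 ≤ 0 := by linarith
    have h5 : ‖x (n + n₀ + 1) - x (n + n₀)‖ ^ 2 ≤ 0 := by
      by_contra hcon
      push Not at hcon
      linarith [mul_pos hc hcon]
    exact ((pow_eq_zero_iff two_ne_zero).1 (le_antisymm h5 (by positivity))).symm

end IsVMiPiano

end VMiPiano

theorem theorem4p8 (N : ℕ) (hN : 1 ≤ N)
    (f : VMiPiano.Vec N → ℝ) (g : VMiPiano.Vec N → EReal)
    -- `f` is `C¹` with Lipschitz continuous gradient on `dom g`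
    (hf : ContDiff ℝ 1 f)
    (Lf : ℝ) (hLf : 0 < Lf)
    (hf_lip : ∀ u ∈ VMiPiano.effDom g, ∀ v ∈ VMiPiano.effDom g,
      ‖gradient f u - gradient f v‖ ≤ Lf * ‖u - v‖)
    -- `g` is proper, lower semicontinuous and prox-bounded
    (hg_proper : VMiPiano.IsProper g)
    (hg_lsc : LowerSemicontinuous g)
    (hg_prox : VMiPiano.IsProxBounded g)
    -- `h = f + g` is coercive and bounded from below
    (hh_coercive : Tendsto (VMiPiano.objective f g)
      (cocompact (VMiPiano.Vec N)) (𝓝 ⊤))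
    (hh_bdd : ∃ c : ℝ, ∀ u, (c : EReal) ≤ VMiPiano.objective f g u)
    -- `F` is a Kurdyka–Łojasiewicz function (on the `(x, y, A, δ)` with `A` positive definite, `δ > 0`)
    (hKL : VMiPiano.IsKLFunctionOn (VMiPiano.lyapunov f g) (VMiPiano.LyapRegion N))
    -- the data of the algorithm
    (σ : ℝ) (α β : ℕ → ℝ) (A : ℕ → Matrix (Fin N) (Fin N) ℝ) (L m : ℕ → ℝ)
    (x : ℕ → VMiPiano.Vec N)
    (hx : VMiPiano.IsVMiPiano f g σ α β A L m x) :
    Summable (fun k => ‖x (k + 1) - x k‖) ∧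
      ∃ xstar : VMiPiano.Vec N, Tendsto x atTop (𝓝 xstar) ∧
        VMiPiano.IsCriticalPoint (VMiPiano.objective f g) xstar ∧
        -gradient f xstar ∈ VMiPiano.limSubdiff g xstar := by
  obtain ⟨ζ, hζ⟩ := hx.exists_tendsto_lyapValue hg_proper.1 hh_bdd
  have hsum := hx.summable_norm_step hg_proper.1 hg_lsc hf hLf.le hf_lip hh_coercive hKL hζ
  obtain ⟨u, hu⟩ := cauchySeq_tendsto_of_complete
    (cauchySeq_of_summable_dist (f := x) (by simpa only [dist_eq_norm_sub'] using hsum))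
  exact ⟨hsum, u, hu, hx.critical_of_tendsto hg_proper.1 hg_lsc hf hLf.le hf_lip hζ hu⟩
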